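/- Let $d\in\mathbb N$ and $\ell\in\{1,\dots,d\}$. For $n\ge 1$ let $K_n=\operatorname{conv}\{X_1,\dots,X_n\}$ be the convex hull of $n$ independent random points with the standard Gaussian distribution on $\mathbb R^d$ (density $(2\pi)^{-d/2}e^{-\|x\|^2/2}$), and let $$V_\ell(K_n)=\binom d\ell\frac{\kappa_d}{\kappa_\ell\,\kappa_{d-\ell}}\int_{G(d,\ell)}\operatorname{vol}_\ell(K_n|L)\,\nu_\ell(dL)$$ be its $\ell$-th intrinsic volume, where $G(d,\ell)$ is the Grassmannian of $\ell$-dimensional linear subspaces of $\mathbb R^d$, $\nu_\ell$ is its rotation invariant (Haar) probability measure, $\operatorname{vol}_\ell(K_n|L)$ is the $\ell$-dimensional Lebesgue measure, within $L$, of the orthogonal projection of $K_n$ onto $L$, and $\kappa_j=\pi^{j/2}/\Gamma(1+j/2)$. Then there are a constant $v_{d,\ell}\in(0,\infty)$ and an index $N$, depending only on $d$ and $\ell$, such that for all $n\ge N$ the random variable $V_\ell(K_n)$ is square integrable and $$\operatorname{Var}[V_\ell(K_n)]\ \ge\ v_{d,\ell}\,(\log n)^{\ell-\frac{d+3}{2}}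 .$$ Consequently, if $(\log n)^{\frac{d+3}{2}-\ell}\operatorname{Var}[V_\ell(K_n)]$ converges to a real number $c_{d,\ell}$ as $n\to\infty$ (as it does by a theorem of Calka and Yukich), then $c_{d,\ell}>0$. -/

import Mathlib

open MeasureTheory ProbabilityTheory Filter Topology

noncomputable section

/-- The Euclidean space `ℝ^d`. -/
abbrev Euc (d : ℕ) : Type := EuclideanSpace ℝ (Fin d)

/-- Taking adjoints is continuous for the operator norm. -/
instance Euc.instContinuousStar (d : ℕ) : ContinuousStar (Euc d →L[ℝ] Euc d) :=
  ⟨(ContinuousLinearMap.adjoint (𝕜 := ℝ) (E := Euc d) (F := Euc d)).continuous⟩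

/-- The orthogonal group `O(d)`: the linear maps `g` of `ℝ^d` with `g* g = g g* = 1`, as a
topological group (operator norm topology). -/
abbrev OrthGroup (d : ℕ) : Type := unitary (Euc d →L[ℝ] Euc d)

instance OrthGroup.instCompactSpace (d : ℕ) : CompactSpace (OrthGroup d) := by
  refine isCompact_iff_compactSpace.1 ?_
  refine Metric.isCompact_of_isClosed_isBounded ?_ ?_
  · exact isClosed_unitary
  · refine (Metric.isBounded_closedBall (x := (0 : Euc d →L[ℝ] Euc d)) (r := 1)).subset ?_
    intro g hg
    rw [mem_closedBall_zero_iff]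
    refine ContinuousLinearMap.opNorm_le_bound _ zero_le_one fun x => ?_
    rw [one_mul]
    exact (ContinuousLinearMap.norm_map_of_mem_unitary hg x).le

/-- The Haar probability measure on `O(d)`. -/
def orthHaar (d : ℕ) : Measure (OrthGroup d) := Measure.haarMeasure ⊤

instance orthHaar.instIsProbabilityMeasure (d : ℕ) : IsProbabilityMeasure (orthHaar d) :=
  ⟨by simpa [orthHaar] using Measure.haarMeasure_self (K₀ := (⊤ : TopologicalSpace.PositiveCompacts
    (OrthGroup d)))⟩

/-- The Grassmannian `G(d, ℓ)` of `ℓ`-dimensional linear subspaces of `ℝ^d`. -/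
def Grass (d ℓ : ℕ) : Type := {L : Submodule ℝ (Euc d) // Module.finrank ℝ L = ℓ}

namespace Grass

variable {d ℓ : ℕ}

/-- The orthogonal projection onto `L`, as an operator on `ℝ^d`. -/
def proj (L : Grass d ℓ) : Euc d →L[ℝ] Euc d := L.1.starProjection

/-- The usual topology of the Grassmannian, given by the metric `‖P_L - P_M‖`. -/
instance instTopologicalSpace : TopologicalSpace (Grass d ℓ) :=
  TopologicalSpace.induced proj inferInstance

instance instMeasurableSpace : MeasurableSpace (Grass d ℓ) := borel _

instance instBorelSpace : BorelSpace (Grass d ℓ) := ⟨rfl⟩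

/-- The image `g L` of a subspace `L` under an orthogonal map `g`. -/
def rotate (g : OrthGroup d) (L : Grass d ℓ) : Grass d ℓ :=
  ⟨L.1.map (Unitary.linearIsometryEquiv g).toLinearEquiv.toLinearMap,
    (LinearEquiv.finrank_map_eq _ _).trans L.2⟩

lemma proj_rotate (g : OrthGroup d) (L : Grass d ℓ) :
    (rotate g L).proj = (g : Euc d →L[ℝ] Euc d) * L.proj * star (g : Euc d →L[ℝ] Euc d) := by
  ext1 x
  exact Submodule.starProjection_map_apply (Unitary.linearIsometryEquiv g) L.1 x

lemma continuous_rotate (L : Grass d ℓ) : Continuous fun g : OrthGroup d => rotate g L := by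
  refine continuous_induced_rng.2 ?_
  have h : (proj ∘ fun g : OrthGroup d => rotate g L) = fun g : OrthGroup d =>
      (g : Euc d →L[ℝ] Euc d) * L.proj * star (g : Euc d →L[ℝ] Euc d) :=
    funext fun g => proj_rotate g L
  rw [h]
  fun_prop

/-- The coordinate subspace spanned by the first `ℓ` standard basis vectors. -/
def coord (hℓ : ℓ ≤ d) : Grass d ℓ :=
  ⟨Submodule.span ℝ (Set.range fun i : Fin ℓ =>
      EuclideanSpace.basisFun (Fin d) ℝ (Fin.castLE hℓ i)), by
    have h := (EuclideanSpace.basisFun (Fin d) ℝ).orthonormal.linearIndependent.comp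
      (Fin.castLE hℓ) (Fin.castLE_injective hℓ)
    exact (finrank_span_eq_card h).trans (Fintype.card_fin ℓ)⟩

/-- The rotation invariant (Haar) probability measure `ν_ℓ` on `G(d, ℓ)`: the law of `g L₀` for a
Haar distributed `g` in `O(d)` and a fixed `L₀` in `G(d, ℓ)`. -/
def haar (hℓ : ℓ ≤ d) : Measure (Grass d ℓ) :=
  (orthHaar d).map fun g => rotate g (coord hℓ)

instance instIsProbabilityMeasureHaar (hℓ : ℓ ≤ d) : IsProbabilityMeasure (haar hℓ) :=
  Measure.isProbabilityMeasure_map (continuous_rotate _).measurable.aemeasurable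

lemma rotate_mul (g h : OrthGroup d) (L : Grass d ℓ) : rotate (g * h) L = rotate g (rotate h L) := by
  apply Subtype.ext
  change Submodule.map _ L.1 = Submodule.map _ (Submodule.map _ L.1)
  rw [← Submodule.map_comp]
  rfl

lemma continuous_rotate_right (g : OrthGroup d) : Continuous (rotate (ℓ := ℓ) g) := by
  refine continuous_induced_rng.2 ?_
  have h : (proj ∘ rotate (ℓ := ℓ) g) = fun L =>
      (g : Euc d →L[ℝ] Euc d) * L.proj * star (g : Euc d →L[ℝ] Euc d) :=
    funext fun L => proj_rotate g L
  rw [h]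
  have : Continuous (proj : Grass d ℓ → _) := continuous_induced_dom
  fun_prop

/-- `ν_ℓ` is invariant under `O(d)`. -/
lemma map_rotate_haar (hℓ : ℓ ≤ d) (g : OrthGroup d) : (haar hℓ).map (rotate g) = haar hℓ := by
  have e : (rotate g ∘ fun h => rotate h (coord hℓ)) = (fun h => rotate h (coord hℓ)) ∘ (g * ·) :=
    funext fun h => (rotate_mul g h _).symm
  have hi : (orthHaar d).map (g * ·) = orthHaar d := by
    unfold orthHaar
    exact map_mul_left_eq_self _ g
  rw [haar, Measure.map_map (continuous_rotate_right g).measurable (continuous_rotate _).measurable,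
    e, ← Measure.map_map (continuous_rotate _).measurable (by fun_prop), hi]

end Grass

/-- The volume `κ_j` of the `j`-dimensional unit ball. -/
def ballVol (j : ℕ) : ℝ := Real.pi ^ ((j : ℝ) / 2) / Real.Gamma (1 + (j : ℝ) / 2)

/-- The `ℓ`-dimensional Lebesgue measure, within `L`, of the orthogonal projection `K | L`.
Here `volume` is the Lebesgue measure of the Euclidean space `L` (a unit cube spanned by an
orthonormal basis of `L` has volume one). -/
def projVol {d ℓ : ℕ} (K : Set (Euc d)) (L : Grass d ℓ) : ℝ :=
  (volume : Measure L.1).real (L.1.orthogonalProjectionOnto '' K)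

/-- The `ℓ`-th intrinsic volume `V_ℓ(K)` of `K ⊆ ℝ^d` (Kubota's formula). -/
def intrinsicVol {d ℓ : ℕ} (hℓ : ℓ ≤ d) (K : Set (Euc d)) : ℝ :=
  (d.choose ℓ : ℝ) * (ballVol d / (ballVol ℓ * ballVol (d - ℓ))) *
    ∫ L, projVol K L ∂(Grass.haar hℓ)

end

/-!
Write `γ` for the standard Gaussian law and `F` for the `ℓ`-th intrinsic volume of the hull of the
sample. For any square integrable centred statistic `S`, Cauchy–Schwarz gives
`Var F ≥ E[F S]² / E[S²]` (`two_mul_sub_le_variance`). The statistic used here is the linear one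
`S = ∑ φ (X_i)` with `φ = 1_A - (γ(A) / γ(B)) 1_B`, where `B` is the unit ball and `A` is the shell
`R ≤ ‖x‖ ≤ R + 1/R` at the radius with `R exp (R²/2) = n`, so that `R² ≍ log n`. This is the range of
norms where the vertices of the hull lie: `n γ(A)` is at most of order `R^(d-1)`
(`exists_stdGaussian_shell_le`), hence so is `E[S²]`.

By Kubota's formula `F` is a constant times the mean over `g ∈ O(d)` of the volume of the hull of the
points `g⁻¹ X_i` projected to the first `ℓ` coordinates (`intrinsicVol_convexHull_range`). Since `φ`
is radial and the law of the sample is rotation invariant, the average over `g` may be dropped in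
`E[F S]` (`integral_meanHullVol_mul`). Conditioning on one point then leaves
`E[F S] = const · n · ∫ φ(x) G(πx) dγ(x)`, where `π` is the coordinate projection and `G(z)` is the
expected volume gained by adding `z` to the hull of `n - 1` Gaussian points of `ℝ^ℓ`
(`integral_hullVol_mul_eval`). All of the geometry thus takes place in `ℝ^ℓ`:

* if `‖z‖ ≥ R`, then `G(z) ≥ c / R` (`exists_le_expGain`): with probability bounded below, no point
  reaches the height `R - 1/R` in direction `z`, while each orthant of a slab of thickness of order
  `1/R` below that height contains a point, and these points span with `z` a box of volume of order
  `1/R` above that height;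
* if `‖z‖ ≤ 1`, then `G(z)` is exponentially small in `n` (`exists_expGain_le`), as `z` lies in the
  hull as soon as each of the orthants `σ_i y_i ≥ 1` contains a point;
* the part of `A` with `‖πx‖ ≥ R` has mass at least of order `R^(ℓ-1) / n`
  (`exists_le_stdGaussian_shell`).

So `E[F S]` is at least of order `R^(ℓ-2)`, and `Var F` at least of order
`R^(2(ℓ-2)-(d-1)) = R^(2ℓ-d-3)`, that is `(log n)^(ℓ-(d+3)/2)`.
-/

/-! ### Volumes of convex hulls of finite point families -/

/-- The volume of the convex hull of a family of points of `ℝ^ℓ`. -/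
noncomputable def hullVol {ι : Type*} {ℓ : ℕ} (p : ι → Euc ℓ) : ℝ :=
  (volume : Measure (Euc ℓ)).real (convexHull ℝ (Set.range p))

lemma hullVol_nonneg {ι : Type*} {ℓ : ℕ} (p : ι → Euc ℓ) : 0 ≤ hullVol p := measureReal_nonneg

lemma volume_hull_lt_top {ℓ : ℕ} {s : Set (Euc ℓ)} (hs : s.Finite) :
    volume (convexHull ℝ s) < ⊤ :=
  (hs.isCompact_convexHull (𝕜 := ℝ)).measure_lt_top

/-- Points close to `p` span a hull inside a thickening of the hull of `p`, whose volume tends to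
that of the hull: the volume of the hull can only jump up in the limit. -/
lemma upperSemicontinuous_hullVol {ι : Type*} [Finite ι] {ℓ : ℕ} :
    UpperSemicontinuous (hullVol : (ι → Euc ℓ) → ℝ) := by
  have := Fintype.ofFinite ι
  intro p y hy
  have hK : IsCompact (convexHull ℝ (Set.range p)) :=
    (Set.finite_range p).isCompact_convexHull (𝕜 := ℝ)
  have h1 : Tendsto (fun r => (volume : Measure (Euc ℓ)).real
      (Metric.cthickening r (convexHull ℝ (Set.range p)))) (𝓝 0) (𝓝 (hullVol p)) :=
    (ENNReal.tendsto_toReal hK.measure_lt_top.ne).comp (tendsto_measure_cthickening_of_isCompact hK)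
  obtain ⟨ε, hε, h2⟩ := Metric.eventually_nhds_iff.1 (h1.eventually_lt_const hy)
  have h3 := @h2 (ε / 2) (by rw [Real.dist_eq, sub_zero, abs_of_pos (half_pos hε)]; linarith)
  filter_upwards [Metric.ball_mem_nhds p (half_pos hε)] with q hq
  refine lt_of_le_of_lt (measureReal_mono ?_ hK.isBounded.cthickening.measure_lt_top.ne) h3
  refine convexHull_min ?_ ((convex_convexHull ℝ _).cthickening _)
  rintro _ ⟨i, rfl⟩
  refine Metric.mem_cthickening_of_dist_le _ (p i) _ _ (subset_convexHull ℝ _ ⟨i, rfl⟩) ?_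
  exact ((dist_le_pi_dist q p i).trans_lt (Metric.mem_ball.1 hq)).le

lemma measurable_hullVol {ι : Type*} [Finite ι] {ℓ : ℕ} :
    Measurable (hullVol : (ι → Euc ℓ) → ℝ) := by
  have := Fintype.ofFinite ι
  exact upperSemicontinuous_hullVol.measurable

lemma hullVol_comp_linearIsometryEquiv {ι : Type*} {ℓ : ℕ} (T : Euc ℓ ≃ₗᵢ[ℝ] Euc ℓ)
    (p : ι → Euc ℓ) : hullVol (fun i => T (p i)) = hullVol p := by
  unfold hullVol
  have h : convexHull ℝ (Set.range fun i => T (p i)) = T '' convexHull ℝ (Set.range p) := by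
    have := LinearMap.image_convexHull (T.toLinearEquiv : Euc ℓ →ₗ[ℝ] Euc ℓ) (Set.range p)
    rw [← Set.range_comp] at this
    exact this.symm
  rw [h, measureReal_def, measureReal_def]
  congr 1
  have h2 := T.symm.measurePreserving.measure_preimage_equiv (f := T.symm.toMeasurableEquiv)
    (convexHull ℝ (Set.range p))
  rw [← h2]
  congr 1
  exact T.toEquiv.image_eq_preimage_symm _

/-- The hull lies in the ball whose radius is the largest norm of the points. -/
lemma hullVol_le {ι : Type*} [Fintype ι] {ℓ : ℕ} (p : ι → Euc ℓ) :
    hullVol p ≤ (volume : Measure (Euc ℓ)).real (Metric.ball 0 1) * ∑ i, ‖p i‖ ^ ℓ := by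
  rcases isEmpty_or_nonempty ι with h | h
  · simp [hullVol, Set.range_eq_empty]
  obtain ⟨i₀, hi₀⟩ := Finite.exists_max fun i => ‖p i‖
  have h1 : convexHull ℝ (Set.range p) ⊆ Metric.closedBall 0 ‖p i₀‖ := by
    refine convexHull_min ?_ (convex_closedBall _ _)
    rintro _ ⟨i, rfl⟩
    simpa using hi₀ i
  calc hullVol p ≤ (volume : Measure (Euc ℓ)).real (Metric.closedBall 0 ‖p i₀‖) :=
        measureReal_mono h1 measure_closedBall_lt_top.ne
    _ = (volume : Measure (Euc ℓ)).real (Metric.ball 0 1) * ‖p i₀‖ ^ ℓ := by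
        rw [measureReal_def, Measure.addHaar_closedBall _ _ (norm_nonneg _), ENNReal.toReal_mul,
          ENNReal.toReal_ofReal (by positivity), finrank_euclideanSpace_fin, mul_comm]; rfl
    _ ≤ _ := by
        gcongr
        exact Finset.single_le_sum (f := fun i => ‖p i‖ ^ ℓ) (fun i _ => by positivity)
          (Finset.mem_univ i₀)

/-! ### Kubota's formula as an integral over the orthogonal group -/

/-- The projection `ℝ^d → ℝ^ℓ` onto the first `ℓ` coordinates. -/
noncomputable def coordMap {d ℓ : ℕ} (hℓ : ℓ ≤ d) : Euc d →L[ℝ] Euc ℓ :=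
  LinearMap.toContinuousLinearMap
    { toFun := fun x => WithLp.toLp 2 fun i => x (Fin.castLE hℓ i)
      map_add' := fun _ _ => rfl
      map_smul' := fun _ _ => rfl }

lemma coordMap_apply {d ℓ : ℕ} (hℓ : ℓ ≤ d) (x : Euc d) (i : Fin ℓ) :
    coordMap hℓ x i = x (Fin.castLE hℓ i) := rfl

lemma norm_coordMap_le {d ℓ : ℕ} (hℓ : ℓ ≤ d) (x : Euc d) : ‖coordMap hℓ x‖ ≤ ‖x‖ := by
  obtain ⟨e, rfl⟩ := Nat.exists_eq_add_of_le hℓ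
  refine le_of_sq_le_sq ?_ (norm_nonneg _)
  rw [EuclideanSpace.norm_sq_eq, EuclideanSpace.norm_sq_eq, Fin.sum_univ_add]
  exact le_add_of_nonneg_right (Finset.sum_nonneg fun i _ => by positivity)

/-- In the orthonormal basis `g e₁, …, g e_ℓ` of `g L₀`, where `L₀` is the coordinate subspace, the
orthogonal projection of `x` onto `g L₀` has the first `ℓ` coordinates of `g⁻¹ x`. -/
lemma projVol_rotate_coord {d ℓ : ℕ} (hℓ : ℓ ≤ d) (g : OrthGroup d) {ι : Type*} (p : ι → Euc d) :
    projVol (convexHull ℝ (Set.range p)) (Grass.rotate g (Grass.coord hℓ)) =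
      hullVol fun i => coordMap hℓ ((Unitary.linearIsometryEquiv g).symm (p i)) := by
  set U := Unitary.linearIsometryEquiv g with hU
  set L := Grass.rotate g (Grass.coord hℓ) with hL
  let b₀ : Fin ℓ → Euc d := fun i => U (EuclideanSpace.basisFun (Fin d) ℝ (Fin.castLE hℓ i))
  have hspan : Submodule.span ℝ (Set.range b₀) = L.1 := by
    change _ = Submodule.map _ (Submodule.span ℝ _)
    rw [Submodule.map_span, ← Set.range_comp]
    rfl
  have hb₀ : Orthonormal ℝ b₀ :=
    (((EuclideanSpace.basisFun (Fin d) ℝ).orthonormal.comp _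
      (Fin.castLE_injective hℓ)).comp_linearIsometryEquiv U)
  have hmem : ∀ i, b₀ i ∈ L.1 := fun i => hspan ▸ Submodule.subset_span ⟨i, rfl⟩
  let b₁ : Fin ℓ → L.1 := fun i => ⟨b₀ i, hmem i⟩
  have hb₁ : Orthonormal ℝ b₁ := by
    rw [← L.1.subtypeₗᵢ.orthonormal_comp_iff]
    exact hb₀
  let b : OrthonormalBasis (Fin ℓ) ℝ L.1 := OrthonormalBasis.mk hb₁ (by
    rw [← Submodule.map_le_map_iff_of_injective L.1.injective_subtype, Submodule.map_span,
      ← Set.range_comp]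
    have : (L.1.subtype ∘ b₁) = b₀ := rfl
    rw [this, hspan]
    exact Submodule.map_subtype_le _ _)
  have hrepr : ∀ x : Euc d, b.repr (L.1.orthogonalProjectionOnto x) = coordMap hℓ (U.symm x) := by
    intro x
    ext i
    rw [b.repr_apply_apply, coordMap_apply]
    have h1 : b i = b₁ i := by simp [b]
    rw [h1, Submodule.inner_orthogonalProjectionOnto_eq_of_mem_left]
    change inner ℝ (U _) x = _
    rw [LinearIsometryEquiv.inner_map_eq_flip]
    simp [EuclideanSpace.inner_single_left]
  have himg : b.repr '' (L.1.orthogonalProjectionOnto '' convexHull ℝ (Set.range p)) =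
      convexHull ℝ (Set.range fun i => coordMap hℓ (U.symm (p i))) := by
    rw [← Set.image_comp]
    have h1 : (b.repr ∘ L.1.orthogonalProjectionOnto) =
        ((coordMap hℓ).toLinearMap ∘ₗ (U.symm.toLinearEquiv : Euc d →ₗ[ℝ] Euc d)) :=
      funext hrepr
    rw [h1, LinearMap.image_convexHull, ← Set.range_comp]
    rfl
  unfold projVol hullVol
  rw [← himg, measureReal_def, measureReal_def]
  congr 1
  have h2 := b.repr.symm.measurePreserving.measure_preimage_equiv
    (f := b.repr.symm.toMeasurableEquiv) (L.1.orthogonalProjectionOnto '' convexHull ℝ (Set.range p))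
  rw [← h2]
  congr 1
  exact (b.repr.toEquiv.image_eq_preimage_symm _).symm

lemma Grass.injective_proj {d ℓ : ℕ} : Function.Injective (Grass.proj : Grass d ℓ → _) :=
  fun _ _ h => Subtype.ext (Submodule.starProjection_inj.1 h)

instance Grass.instT2Space {d ℓ : ℕ} : T2Space (Grass d ℓ) :=
  T2Space.of_injective_continuous Grass.injective_proj continuous_induced_dom

/-- The point tuple `(g⁻¹ x₁, …, g⁻¹ xₙ)` projected to the first `ℓ` coordinates. -/
noncomputable def rotCoord {d ℓ : ℕ} (hℓ : ℓ ≤ d) {ι : Type*} (g : OrthGroup d) (p : ι → Euc d) :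
    ι → Euc ℓ :=
  fun i => coordMap hℓ ((Unitary.linearIsometryEquiv g).symm (p i))

lemma continuous_rotCoord {d ℓ : ℕ} (hℓ : ℓ ≤ d) {ι : Type*} :
    Continuous fun x : OrthGroup d × (ι → Euc d) => rotCoord hℓ x.1 x.2 := by
  refine continuous_pi fun i => (coordMap hℓ).continuous.comp ?_
  have h : (fun x : OrthGroup d × (ι → Euc d) => (Unitary.linearIsometryEquiv x.1).symm (x.2 i)) =
      fun x => (star (x.1 : Euc d →L[ℝ] Euc d)) (x.2 i) := rfl
  rw [h]
  have h1 : Continuous fun x : OrthGroup d × (ι → Euc d) => star (x.1 : Euc d →L[ℝ] Euc d) := by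
    fun_prop
  exact h1.clm_apply (by fun_prop)

/-- The superlevel sets of `L ↦ vol (K | L)` inside the orbit of `L₀` are images of compact sets,
by upper semicontinuity; the orbit has full measure. -/
lemma aemeasurable_projVol {d ℓ : ℕ} (hℓ : ℓ ≤ d) {ι : Type*} [Finite ι] (p : ι → Euc d) :
    AEMeasurable (projVol (convexHull ℝ (Set.range p))) (Grass.haar hℓ) := by
  set q : OrthGroup d → Grass d ℓ := fun g => Grass.rotate g (Grass.coord hℓ) with hq
  have hqc : Continuous q := Grass.continuous_rotate _
  set f : Grass d ℓ → ℝ := projVol (convexHull ℝ (Set.range p)) with hf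
  have husc : UpperSemicontinuous (f ∘ q) := by
    have h1 : f ∘ q = fun g => hullVol (rotCoord hℓ g p) :=
      funext fun g => projVol_rotate_coord hℓ g p
    have h4 : Continuous fun g : OrthGroup d => rotCoord hℓ g p :=
      Continuous.comp (g := fun x : OrthGroup d × (ι → Euc d) => rotCoord hℓ x.1 x.2)
        (f := fun g => (g, p)) (continuous_rotCoord hℓ) (by fun_prop)
    rw [h1]
    exact fun g y hy => h4.continuousAt.eventually (upperSemicontinuous_hullVol _ y hy)
  have hr : MeasurableSet (Set.range q) := (isCompact_range hqc).isClosed.measurableSet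
  refine ⟨(Set.range q).indicator f, measurable_of_Ici fun c => ?_, ?_⟩
  · rcases le_or_gt c 0 with hc | hc
    · convert MeasurableSet.univ
      refine Set.eq_univ_of_forall fun L => hc.trans ?_
      exact Set.indicator_nonneg (fun _ _ => measureReal_nonneg) _
    · have h2 : (Set.range q).indicator f ⁻¹' Set.Ici c = q '' ((f ∘ q) ⁻¹' Set.Ici c) := by
        ext L
        simp only [Set.mem_preimage, Set.mem_Ici, Set.mem_image, Function.comp_apply]
        constructor
        · intro h
          by_cases hL : L ∈ Set.range q
          · obtain ⟨g, rfl⟩ := hL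
            exact ⟨g, by simpa using h, rfl⟩
          · rw [Set.indicator_of_notMem hL] at h
            exact absurd h hc.not_ge
        · rintro ⟨g, h, rfl⟩
          rwa [Set.indicator_of_mem (s := Set.range q) ⟨g, rfl⟩]
      rw [h2]
      exact ((husc.isClosed_preimage c).isCompact.image hqc).isClosed.measurableSet
  · have h3 : ∀ᵐ L ∂(Grass.haar hℓ), L ∈ Set.range q :=
      (ae_map_iff hqc.measurable.aemeasurable hr).2 (Eventually.of_forall fun g => ⟨g, rfl⟩)
    filter_upwards [h3] with L hL
    rw [Set.indicator_of_mem hL]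

/-- The constant in Kubota's formula. -/
noncomputable def kubotaConst (d ℓ : ℕ) : ℝ :=
  (d.choose ℓ : ℝ) * (ballVol d / (ballVol ℓ * ballVol (d - ℓ)))

lemma kubotaConst_pos {d ℓ : ℕ} (hℓ : ℓ ≤ d) : 0 < kubotaConst d ℓ := by
  have h : ∀ j, 0 < ballVol j := fun j =>
    div_pos (Real.rpow_pos_of_pos Real.pi_pos _) (Real.Gamma_pos_of_pos (by positivity))
  have h1 : (0 : ℝ) < d.choose ℓ := by exact_mod_cast Nat.choose_pos hℓ
  exact mul_pos h1 (div_pos (h _) (mul_pos (h _) (h _)))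

lemma intrinsicVol_convexHull_range {d ℓ : ℕ} (hℓ : ℓ ≤ d) {ι : Type*} [Finite ι]
    (p : ι → Euc d) :
    intrinsicVol hℓ (convexHull ℝ (Set.range p)) =
      kubotaConst d ℓ * ∫ g, hullVol (rotCoord hℓ g p) ∂(orthHaar d) := by
  unfold intrinsicVol kubotaConst
  congr 1
  rw [Grass.haar, integral_map (Grass.continuous_rotate _).measurable.aemeasurable
    (aemeasurable_projVol hℓ p).aestronglyMeasurable]
  exact integral_congr_ae (Eventually.of_forall fun g => projVol_rotate_coord hℓ g p)

lemma measurable_hullVol_rotCoord {d ℓ : ℕ} (hℓ : ℓ ≤ d) {ι : Type*} [Finite ι] :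
    Measurable fun x : OrthGroup d × (ι → Euc d) => hullVol (rotCoord hℓ x.1 x.2) :=
  measurable_hullVol.comp (continuous_rotCoord hℓ).measurable

lemma norm_rotCoord_le {d ℓ : ℕ} (hℓ : ℓ ≤ d) {ι : Type*} (g : OrthGroup d) (p : ι → Euc d)
    (i : ι) : ‖rotCoord hℓ g p i‖ ≤ ‖p i‖ :=
  (norm_coordMap_le hℓ _).trans (LinearIsometryEquiv.norm_map _ _).le

/-! ### The Gaussian density -/

/-- The normalizing constant of the standard Gaussian density on `ℝ^d`. -/
noncomputable def gaussConst (d : ℕ) : ℝ := (∫ x : Euc d, Real.exp (-(1 / 2 : ℝ) * ‖x‖ ^ 2))⁻¹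

lemma integral_exp_neg_half_sq_pos (d : ℕ) :
    0 < ∫ x : Euc d, Real.exp (-(1 / 2 : ℝ) * ‖x‖ ^ 2) := by
  rw [GaussianFourier.integral_rexp_neg_mul_sq_norm (by norm_num : (0 : ℝ) < 1 / 2)]
  positivity

lemma gaussConst_pos (d : ℕ) : 0 < gaussConst d := inv_pos.2 (integral_exp_neg_half_sq_pos d)

lemma integrable_exp_neg_half_sq (d : ℕ) :
    Integrable fun x : Euc d => Real.exp (-(1 / 2 : ℝ) * ‖x‖ ^ 2) :=
  Integrable.of_integral_ne_zero (integral_exp_neg_half_sq_pos d).ne'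

/-- Both sides are finite measures with the same characteristic function. -/
lemma stdGaussian_eq_withDensity (d : ℕ) :
    stdGaussian (Euc d) = (volume : Measure (Euc d)).withDensity
      fun x => ENNReal.ofReal (gaussConst d * Real.exp (-(1 / 2 : ℝ) * ‖x‖ ^ 2)) := by
  have hint := (integrable_exp_neg_half_sq d).const_mul (gaussConst d)
  have : IsFiniteMeasure ((volume : Measure (Euc d)).withDensity
      fun x => ENNReal.ofReal (gaussConst d * Real.exp (-(1 / 2 : ℝ) * ‖x‖ ^ 2))) :=
    isFiniteMeasure_withDensity_ofReal hint.2
  refine Measure.ext_of_charFun ?_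
  ext t
  have hb : 0 < (1 / 2 : ℂ).re := by norm_num
  have hK : ((∫ x : Euc d, Real.exp (-(1 / 2 : ℝ) * ‖x‖ ^ 2) : ℝ) : ℂ) =
      (Real.pi / (1 / 2 : ℂ)) ^ (Module.finrank ℝ (Euc d) / 2 : ℂ) := by
    rw [← integral_complex_ofReal]
    have h := GaussianFourier.integral_cexp_neg_mul_sq_norm_add (V := Euc d) hb 0 0
    simp only [inner_zero_left, Complex.ofReal_zero, mul_zero, add_zero, norm_zero] at h
    rw [show (Complex.exp ((0 : ℂ) ^ 2 * 0 ^ 2 / (4 * (1 / 2)))) = 1 by simp, mul_one] at h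
    rw [← h]
    congr 1
    ext x
    push_cast
    rfl
  rw [charFun_stdGaussian, charFun_apply, integral_withDensity_eq_integral_toReal_smul (by fun_prop)
    (by simp)]
  have h := GaussianFourier.integral_cexp_neg_mul_sq_norm_add (V := Euc d) hb Complex.I t
  have h1 : ∀ x : Euc d, (ENNReal.ofReal (gaussConst d *
      Real.exp (-(1 / 2 : ℝ) * ‖x‖ ^ 2))).toReal • Complex.exp ((inner ℝ x t : ℝ) * Complex.I) =
      (gaussConst d : ℂ) *
        Complex.exp (-(1 / 2 : ℂ) * ‖x‖ ^ 2 + Complex.I * (inner ℝ t x : ℝ)) := by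
    intro x
    rw [ENNReal.toReal_ofReal (mul_nonneg (gaussConst_pos d).le (Real.exp_pos _).le),
      Complex.real_smul, Complex.exp_add, real_inner_comm]
    push_cast
    ring_nf
  simp_rw [h1]
  rw [integral_const_mul, h, ← hK, gaussConst]
  have h2 : ((∫ x : Euc d, Real.exp (-(1 / 2 : ℝ) * ‖x‖ ^ 2) : ℝ) : ℂ) ≠ 0 :=
    Complex.ofReal_ne_zero.2 (integral_exp_neg_half_sq_pos d).ne'
  rw [← mul_assoc, Complex.ofReal_inv, inv_mul_cancel₀ h2, one_mul]
  congr 1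
  rw [Complex.I_sq]
  ring

lemma stdGaussian_real_le {d : ℕ} {S : Set (Euc d)} (hS : MeasurableSet S) (hv : volume S ≠ ⊤)
    {R : ℝ} (hR : 0 ≤ R) (h : ∀ x ∈ S, R ≤ ‖x‖) :
    (stdGaussian (Euc d)).real S ≤
      gaussConst d * Real.exp (-(1 / 2) * R ^ 2) * (volume : Measure (Euc d)).real S := by
  have hc := (gaussConst_pos d).le
  rw [measureReal_def, stdGaussian_eq_withDensity, withDensity_apply _ hS, measureReal_def]
  refine ENNReal.toReal_le_of_le_ofReal (by positivity) ?_
  rw [ENNReal.ofReal_mul (by positivity), ENNReal.ofReal_toReal hv, ← setLIntegral_const]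
  refine setLIntegral_mono' hS fun x hx => ENNReal.ofReal_le_ofReal ?_
  have := h x hx
  gcongr gaussConst d * Real.exp ?_
  nlinarith [mul_self_le_mul_self hR this]

lemma le_stdGaussian_real {d : ℕ} {S : Set (Euc d)} (hS : MeasurableSet S) 
    {R : ℝ} (h : ∀ x ∈ S, ‖x‖ ≤ R) :
    gaussConst d * Real.exp (-(1 / 2) * R ^ 2) * (volume : Measure (Euc d)).real S ≤
      (stdGaussian (Euc d)).real S := by
  have hc := (gaussConst_pos d).le
  have h1 : ENNReal.ofReal (gaussConst d * Real.exp (-(1 / 2) * R ^ 2)) * volume S ≤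
      stdGaussian (Euc d) S := by
    rw [stdGaussian_eq_withDensity, withDensity_apply _ hS, ← setLIntegral_const]
    refine setLIntegral_mono' hS fun x hx => ENNReal.ofReal_le_ofReal ?_
    have h2 := h x hx
    gcongr gaussConst d * Real.exp ?_
    nlinarith [mul_self_le_mul_self (norm_nonneg x) h2]
  have h3 := ENNReal.toReal_mono (measure_ne_top _ _) h1
  rwa [ENNReal.toReal_mul, ENNReal.toReal_ofReal (by positivity)] at h3

/-- The spherical shell `{x | a ≤ ‖x‖ ≤ b}`. -/
def shell (d : ℕ) (a b : ℝ) : Set (Euc d) := {x | a ≤ ‖x‖ ∧ ‖x‖ ≤ b}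

lemma measurableSet_shell (d : ℕ) (a b : ℝ) : MeasurableSet (shell d a b) :=
  (measurableSet_le measurable_const measurable_norm).inter
    (measurableSet_le measurable_norm measurable_const)

lemma volume_shell_ne_top (d : ℕ) (a b : ℝ) : volume (shell d a b) ≠ ⊤ := by
  refine ((measure_mono ?_).trans_lt (measure_closedBall_lt_top (x := (0 : Euc d)) (r := b))).ne
  intro x hx
  simpa using hx.2

lemma volume_ball_one_pos (d : ℕ) : 0 < (volume : Measure (Euc d)).real (Metric.ball 0 1) :=
  ENNReal.toReal_pos (Metric.measure_ball_pos _ _ one_pos).ne' measure_ball_lt_top.ne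

lemma volume_shell {d : ℕ} (hd : 0 < d) {a b : ℝ} (ha : 0 ≤ a) (hab : a ≤ b) :
    (volume : Measure (Euc d)).real (shell d a b) =
      (volume : Measure (Euc d)).real (Metric.ball 0 1) * (b ^ d - a ^ d) := by
  have h1 : shell d a b = Metric.closedBall 0 b \ Metric.ball 0 a := by
    ext x
    simp [shell, and_comm]
  have h2 : ∀ r : ℝ, 0 ≤ r → (volume : Measure (Euc d)).real (Metric.closedBall 0 r) =
      (volume : Measure (Euc d)).real (Metric.ball 0 1) * r ^ d := fun r hr => by
    rw [measureReal_def, Measure.addHaar_closedBall _ _ hr, ENNReal.toReal_mul,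
      ENNReal.toReal_ofReal (by positivity), finrank_euclideanSpace_fin, mul_comm]; rfl
  have h3 : (volume : Measure (Euc d)).real (Metric.ball 0 a) =
      (volume : Measure (Euc d)).real (Metric.ball 0 1) * a ^ d := by
    have : Nonempty (Fin d) := ⟨⟨0, hd⟩⟩
    rw [measureReal_def, Measure.addHaar_ball _ _ ha, ENNReal.toReal_mul,
      ENNReal.toReal_ofReal (by positivity), finrank_euclideanSpace_fin, mul_comm]; rfl
  rw [h1, measureReal_sdiff (Metric.ball_subset_closedBall.trans
    (Metric.closedBall_subset_closedBall hab)) measurableSet_ball measure_closedBall_lt_top.ne,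
    h2 b (ha.trans hab), h3]
  ring

/-! ### One-dimensional Gaussian estimates -/

lemma gaussianPDFReal_zero_one (x : ℝ) :
    gaussianPDFReal 0 1 x = (√(2 * Real.pi))⁻¹ * Real.exp (-(1 / 2) * x ^ 2) := by
  simp only [gaussianPDFReal_def, NNReal.coe_one, mul_one, sub_zero]
  congr 2
  ring

lemma gaussianReal_Ici_le {s : ℝ} (hs : 0 < s) :
    (gaussianReal 0 1).real (Set.Ici s) ≤ Real.exp (-(1 / 2) * s ^ 2) / s := by
  rw [measureReal_def, gaussianReal_apply_eq_integral _ one_ne_zero,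
    ENNReal.toReal_ofReal (setIntegral_nonneg measurableSet_Ici fun x _ =>
      gaussianPDFReal_nonneg _ _ _), integral_Ici_eq_integral_Ioi]
  have h1 := integral_exp_mul_Ioi (neg_lt_zero.2 hs) s
  have h2 : ∫ x in Set.Ioi s, Real.exp (s ^ 2 / 2) * Real.exp (-s * x) =
      Real.exp (-(1 / 2) * s ^ 2) / s := by
    rw [integral_const_mul, h1, neg_div_neg_eq, ← mul_div_assoc, ← Real.exp_add]
    congr 2
    ring
  rw [← h2]
  refine setIntegral_mono_on (integrable_gaussianPDFReal _ _).integrableOn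
    ((integrableOn_exp_mul_Ioi (neg_lt_zero.2 hs) s).const_mul _) measurableSet_Ioi fun x _ => ?_
  rw [gaussianPDFReal_zero_one, ← Real.exp_add]
  have h3 : (√(2 * Real.pi))⁻¹ ≤ 1 := by
    refine inv_le_one_of_one_le₀ (Real.one_le_sqrt.2 ?_)
    linarith [Real.two_le_pi]
  calc (√(2 * Real.pi))⁻¹ * Real.exp (-(1 / 2) * x ^ 2) ≤ 1 * Real.exp (-(1 / 2) * x ^ 2) := by
        gcongr
    _ ≤ _ := by
        rw [one_mul]
        gcongr
        nlinarith [sq_nonneg (x - s)]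

lemma le_gaussianReal_Ico {a b : ℝ} (ha : 0 ≤ a) (hab : a ≤ b) :
    (b - a) * ((√(2 * Real.pi))⁻¹ * Real.exp (-(1 / 2) * b ^ 2)) ≤
      (gaussianReal 0 1).real (Set.Ico a b) := by
  rw [measureReal_def, gaussianReal_apply_eq_integral _ one_ne_zero,
    ENNReal.toReal_ofReal (setIntegral_nonneg measurableSet_Ico fun x _ =>
      gaussianPDFReal_nonneg _ _ _)]
  have h1 : ∫ _ in Set.Ico a b, ((√(2 * Real.pi))⁻¹ * Real.exp (-(1 / 2) * b ^ 2)) =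
      (b - a) * ((√(2 * Real.pi))⁻¹ * Real.exp (-(1 / 2) * b ^ 2)) := by
    rw [setIntegral_const, smul_eq_mul, Real.volume_real_Ico_of_le hab]
  rw [← h1]
  refine setIntegral_mono_on (integrableOn_const (by simp))
    (integrable_gaussianPDFReal _ _).integrableOn measurableSet_Ico fun x hx => ?_
  rw [gaussianPDFReal_zero_one]
  gcongr (√(2 * Real.pi))⁻¹ * Real.exp ?_
  nlinarith [hx.1, hx.2]

lemma gaussianReal_Ici_pos (s : ℝ) : 0 < (gaussianReal 0 1).real (Set.Ici s) := by
  refine ENNReal.toReal_pos (fun h => ?_) (measure_ne_top _ _)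
  have := gaussianReal_absolutelyContinuous' 0 one_ne_zero h
  simp at this

lemma gaussianReal_le_mul_sign (s : ℝ) {σ : ℝ} (hσ : σ = 1 ∨ σ = -1) :
    (gaussianReal 0 1).real {y | s ≤ σ * y} = (gaussianReal 0 1).real (Set.Ici s) := by
  rcases hσ with rfl | rfl
  · simp [Set.Ici]
  · have h : (gaussianReal 0 1).map (fun y => -y) = gaussianReal 0 1 := by
      simpa using gaussianReal_map_neg (μ := 0) (v := 1)
    conv_rhs => rw [← h]
    rw [map_measureReal_apply measurable_neg measurableSet_Ici]
    simp [Set.preimage, Set.Ici]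

/-! ### Coordinates and moments of the standard Gaussian -/

lemma stdGaussian_real_eq_pi {d : ℕ} {S : Set (Euc d)} (hS : MeasurableSet S) :
    (stdGaussian (Euc d)).real S =
      (Measure.pi fun _ : Fin d => gaussianReal 0 1).real {y | WithLp.toLp 2 y ∈ S} := by
  rw [← map_pi_eq_stdGaussian, map_measureReal_apply (by fun_prop) hS]
  rfl

lemma stdGaussian_real_box {d : ℕ} (s : Fin d → Set ℝ) (hs : ∀ i, MeasurableSet (s i)) :
    (stdGaussian (Euc d)).real {x | ∀ i, x i ∈ s i} = ∏ i, (gaussianReal 0 1).real (s i) := by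
  have h : MeasurableSet {x : Euc d | ∀ i, x i ∈ s i} := by
    rw [Set.ofPred_forall]
    exact MeasurableSet.iInter fun i => (by fun_prop : Measurable fun x : Euc d => x i) (hs i)
  rw [stdGaussian_real_eq_pi h]
  have h2 : {y : Fin d → ℝ | WithLp.toLp 2 y ∈ {x : Euc d | ∀ i, x i ∈ s i}} =
      Set.univ.pi s := by
    ext y
    simp
  rw [h2, measureReal_def, Measure.pi_pi, ENNReal.toReal_prod]
  rfl

lemma measurePreserving_split (ℓ e : ℕ) (μ : Measure ℝ) [SigmaFinite μ] :
    MeasurePreserving (fun x : Fin (ℓ + e) → ℝ =>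
      ((fun i => x (Fin.castAdd e i) : Fin ℓ → ℝ), (fun j => x (Fin.natAdd ℓ j) : Fin e → ℝ)))
      (Measure.pi fun _ => μ) ((Measure.pi fun _ => μ).prod (Measure.pi fun _ => μ)) :=
  (measurePreserving_sumPiEquivProdPi (fun _ : Fin ℓ ⊕ Fin e => μ)).comp
    (measurePreserving_piCongrLeft (fun _ : Fin (ℓ + e) => μ) finSumFinEquiv).symm

/-- The first `ℓ` coordinates and the remaining ones are independent. -/
lemma stdGaussian_real_split {ℓ e : ℕ} {U : Set (Euc ℓ)} (hU : MeasurableSet U) {V : Set ℝ}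
    (hV : MeasurableSet V) :
    (stdGaussian (Euc (ℓ + e))).real
      {x | coordMap (Nat.le_add_right ℓ e) x ∈ U ∧ ∀ j, x (Fin.natAdd ℓ j) ∈ V} =
      (stdGaussian (Euc ℓ)).real U * (gaussianReal 0 1).real V ^ e := by
  have hU' : MeasurableSet {y : Fin ℓ → ℝ | WithLp.toLp 2 y ∈ U} :=
    (by fun_prop : Measurable fun y : Fin ℓ → ℝ => (WithLp.toLp 2 y : Euc ℓ)) hU
  have hV' : MeasurableSet (Set.univ.pi fun _ : Fin e => V) :=
    MeasurableSet.univ_pi fun _ => hV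
  have h1 : MeasurableSet
      {x : Euc (ℓ + e) | coordMap (Nat.le_add_right ℓ e) x ∈ U ∧ ∀ j, x (Fin.natAdd ℓ j) ∈ V} := by
    have h2 : MeasurableSet {x : Euc (ℓ + e) | ∀ j, x (Fin.natAdd ℓ j) ∈ V} := by
      rw [Set.ofPred_forall]
      exact MeasurableSet.iInter fun i =>
        (by fun_prop : Measurable fun x : Euc (ℓ + e) => x (Fin.natAdd ℓ i)) hV
    exact ((coordMap _).continuous.measurable hU).inter h2
  have h2 := (measurePreserving_split ℓ e (gaussianReal 0 1)).measureReal_preimage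
    (hU'.prod hV').nullMeasurableSet
  rw [stdGaussian_real_eq_pi h1, stdGaussian_real_eq_pi hU]
  rw [measureReal_prod_prod] at h2
  rw [measureReal_def (Measure.pi fun _ : Fin e => gaussianReal 0 1), Measure.pi_pi,
    Finset.prod_const, ENNReal.toReal_pow, Finset.card_univ, Fintype.card_fin] at h2
  refine Eq.trans ?_ h2
  congr 1
  ext y
  have h3 : coordMap (Nat.le_add_right ℓ e) (WithLp.toLp 2 y) =
      WithLp.toLp 2 fun i => y (Fin.castAdd e i) := rfl
  simp [h3]

lemma measurePreserving_coordMap {d ℓ : ℕ} (hℓ : ℓ ≤ d) :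
    MeasurePreserving (coordMap hℓ) (stdGaussian (Euc d)) (stdGaussian (Euc ℓ)) := by
  obtain ⟨e, rfl⟩ := Nat.exists_eq_add_of_le hℓ
  refine ⟨(coordMap hℓ).continuous.measurable, ?_⟩
  have := Measure.isProbabilityMeasure_map (μ := stdGaussian (Euc (ℓ + e)))
    (coordMap hℓ).continuous.measurable.aemeasurable
  refine Measure.ext fun U hU => ?_
  rw [← measureReal_eq_measureReal_iff,
    map_measureReal_apply (coordMap hℓ).continuous.measurable hU]
  have h := stdGaussian_real_split (e := e) hU MeasurableSet.univ
  simp only [Set.mem_univ, implies_true, and_true, probReal_univ, one_pow, mul_one] at h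
  exact h

lemma memLp_norm_pow_stdGaussian (d k : ℕ) :
    MemLp (fun x : Euc d => ‖x‖ ^ k) 2 (stdGaussian (Euc d)) := by
  rcases Nat.eq_zero_or_pos k with rfl | hk
  · simpa using memLp_const 1
  rw [memLp_two_iff_integrable_sq (by fun_prop)]
  have h := (IsGaussian.memLp_id (stdGaussian (Euc d)) ((2 * k : ℕ) : ENNReal)
    (ENNReal.natCast_ne_top _)).integrable_norm_pow (by omega)
  simpa [← pow_mul, mul_comm] using h

/-! ### The volume gained by adding one point to a convex hull -/

lemma hullVol_mono {ι κ : Type*} [Finite κ] {ℓ : ℕ} {p : ι → Euc ℓ} {q : κ → Euc ℓ}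
    (h : Set.range p ⊆ convexHull ℝ (Set.range q)) : hullVol p ≤ hullVol q :=
  measureReal_mono (convexHull_min h (convex_convexHull ℝ _))
    (volume_hull_lt_top (Set.finite_range q)).ne

lemma hullVol_le_cons {m ℓ : ℕ} (z : Euc ℓ) (Z : Fin m → Euc ℓ) :
    hullVol Z ≤ hullVol (Fin.cons z Z : Fin (m + 1) → Euc ℓ) := by
  refine hullVol_mono ((subset_convexHull ℝ _).trans (convexHull_mono ?_))
  rw [Fin.range_cons]
  exact Set.subset_insert _ _

lemma hullVol_cons_of_mem {m ℓ : ℕ} {z : Euc ℓ} {Z : Fin m → Euc ℓ}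
    (h : z ∈ convexHull ℝ (Set.range Z)) :
    hullVol (Fin.cons z Z : Fin (m + 1) → Euc ℓ) = hullVol Z := by
  refine le_antisymm (hullVol_mono ?_) (hullVol_le_cons z Z)
  rw [Fin.range_cons]
  exact Set.insert_subset h (subset_convexHull ℝ _)

/-- The sign `±1` encoded by a Boolean. -/
def boolSign (b : Bool) : ℝ := if b then 1 else -1

lemma boolSign_eq (b : Bool) : boolSign b = 1 ∨ boolSign b = -1 := by
  cases b <;> simp [boolSign]

/-- The sign pattern of `v` picks an orthant in which `⟨v, y⟩` is at least the `ℓ¹`-norm of `v`. -/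
lemma abs_le_mul_of_one_le_boolSign {v y : ℝ} (h : 1 ≤ boolSign (decide (0 ≤ v)) * y) :
    |v| ≤ v * y := by
  by_cases hv : 0 ≤ v
  · simp only [hv, decide_true, boolSign, if_true, one_mul] at h
    rw [abs_of_nonneg hv]
    nlinarith
  · simp only [hv, decide_false, boolSign] at h
    rw [abs_of_neg (not_le.1 hv)]
    simp at h
    nlinarith [not_le.1 hv]

lemma strongDual_apply_eq_sum {n : ℕ} (f : StrongDual ℝ (Euc n)) (y : Euc n) :
    f y = ∑ i, f (EuclideanSpace.single i 1) * y i := by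
  have h : y = ∑ i, y i • (EuclideanSpace.single i 1 : Euc n) := by
    have := (EuclideanSpace.basisFun (Fin n) ℝ).sum_repr y
    simpa using this.symm
  conv_lhs => rw [h]
  simp [mul_comm]

lemma convexHull_range_separation {ι : Type*} [Finite ι] {n : ℕ} {Z : ι → Euc n} {w : Euc n}
    (hw : w ∉ convexHull ℝ (Set.range Z)) :
    ∃ f : StrongDual ℝ (Euc n), ∀ b ∈ convexHull ℝ (Set.range Z), f b < f w := by
  obtain ⟨f, u, h1, h2⟩ := geometric_hahn_banach_closed_point (convex_convexHull ℝ (Set.range Z))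
    ((Set.finite_range Z).isCompact_convexHull (𝕜 := ℝ)).isClosed hw
  exact ⟨f, fun b hb => (h1 b hb).trans h2⟩

/-- The translated orthant of the points `y` with `σ_i y_i ≥ 1` for all `i`. -/
def orthant {n : ℕ} (σ : Fin n → Bool) : Set (Euc n) := {y | ∀ i, 1 ≤ boolSign (σ i) * y i}

lemma mem_convexHull_of_orthants {ι : Type*} [Finite ι] {n : ℕ} {Z : ι → Euc n} {w : Euc n}
    (hw : ‖w‖ ≤ 1) (h : ∀ σ : Fin n → Bool, ∃ j, Z j ∈ orthant σ) :
    w ∈ convexHull ℝ (Set.range Z) := by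
  by_contra hcon
  obtain ⟨f, hf⟩ := convexHull_range_separation hcon
  obtain ⟨j, hj⟩ := h fun i => decide (0 ≤ f (EuclideanSpace.single i 1))
  refine (hf (Z j) (subset_convexHull ℝ _ ⟨j, rfl⟩)).not_ge ?_
  rw [strongDual_apply_eq_sum f w, strongDual_apply_eq_sum f (Z j)]
  refine Finset.sum_le_sum fun i _ => le_trans ?_ (abs_le_mul_of_one_le_boolSign (hj i))
  calc f (EuclideanSpace.single i 1) * w i ≤ |f (EuclideanSpace.single i 1)| * |w i| := by
        rw [← abs_mul]; exact le_abs_self _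
    _ ≤ |f (EuclideanSpace.single i 1)| * 1 := by
        gcongr
        exact (PiLp.norm_apply_le w i).trans hw
    _ = _ := mul_one _

/-- The part of the orthant with sign pattern `σ` in the last `k` coordinates that lies in the slab
`a - h ≤ y₀ < a`. -/
def slabOrthant {k : ℕ} (a h : ℝ) (σ : Fin k → Bool) : Set (Euc (k + 1)) :=
  {y | y 0 ∈ Set.Ico (a - h) a ∧ ∀ i : Fin k, 1 ≤ boolSign (σ i) * y i.succ}

/-- The box `[a, a + η/2] × [-δ, δ]^k`. -/
def capBox (k : ℕ) (a η δ : ℝ) : Set (Euc (k + 1)) :=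
  {w | w 0 ∈ Set.Icc a (a + η / 2) ∧ ∀ i : Fin k, w i.succ ∈ Set.Icc (-δ) δ}

/-- A separating functional would have to lie below its value at `w` on the segment from `z` to the
point of the slab orthant singled out by its signs; the point of this segment at the height of `w`
has the wrong value. -/
lemma capBox_subset_convexHull {m k : ℕ} {a h η t : ℝ} (hh : 0 ≤ h) (hη : 0 < η) (ht : a + η ≤ t)
    {Z : Fin m → Euc (k + 1)} (hZ : ∀ σ, ∃ j, Z j ∈ slabOrthant a h σ) :
    capBox k a η (η / (2 * (η + h))) ⊆ convexHull ℝ (Set.range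
      (Fin.cons (EuclideanSpace.single 0 t) Z : Fin (m + 1) → Euc (k + 1))) := by
  intro w hw
  by_contra hcon
  set z : Euc (k + 1) := EuclideanSpace.single 0 t with hz
  obtain ⟨f, hf⟩ := convexHull_range_separation hcon
  obtain ⟨j, hj, hj'⟩ := hZ fun i => decide (0 ≤ f (EuclideanSpace.single i.succ 1))
  obtain ⟨⟨hw1, hw2⟩, hw3⟩ := hw
  have hpos : 0 < t - Z j 0 := by linarith [hj.2]
  set c : ℝ := (t - w 0) / (t - Z j 0) with hc
  have hc0 : η / (2 * (η + h)) ≤ c := by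
    rw [hc, div_le_div_iff₀ (by linarith) hpos]
    nlinarith [hj.1, mul_nonneg hη.le (by linarith : 0 ≤ t - w 0 - η / 2),
      mul_nonneg hh (by linarith : 0 ≤ t - w 0 - η / 2),
      mul_nonneg hη.le (by linarith [hj.1] : 0 ≤ Z j 0 - (a - h))]
  have hδ : 0 < η / (2 * (η + h)) := by positivity
  have hc1 : c ≤ 1 := by
    rw [hc, div_le_one hpos]
    linarith [hj.2]
  have hmem : c • Z j + (1 - c) • z ∈ convexHull ℝ (Set.range
      (Fin.cons z Z : Fin (m + 1) → Euc (k + 1))) := by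
    refine convex_convexHull ℝ _ (subset_convexHull ℝ _ ?_) (subset_convexHull ℝ _ ?_)
      (hδ.le.trans hc0) (by linarith) (by ring)
    · rw [Fin.range_cons]; exact Or.inr ⟨j, rfl⟩
    · rw [Fin.range_cons]; exact Or.inl rfl
  refine (hf _ hmem).not_ge ?_
  have hz0 : z 0 = t := by simp [hz]
  have hzs : ∀ i : Fin k, z i.succ = 0 := fun i => by simp [hz]
  have hcw : c * Z j 0 + (1 - c) * t = w 0 := by
    have : c * (t - Z j 0) = t - w 0 := by rw [hc]; field_simp
    linarith
  rw [strongDual_apply_eq_sum f w, strongDual_apply_eq_sum f (c • Z j + (1 - c) • z),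
    Fin.sum_univ_succ, Fin.sum_univ_succ]
  simp only [PiLp.add_apply, PiLp.smul_apply, smul_eq_mul, hz0, hzs, hcw, mul_zero, add_zero]
  refine add_le_add le_rfl (Finset.sum_le_sum fun i _ => ?_)
  have h1 := abs_le_mul_of_one_le_boolSign (hj' i)
  set v := f (EuclideanSpace.single i.succ 1)
  calc v * w i.succ ≤ |v| * |w i.succ| := by rw [← abs_mul]; exact le_abs_self _
    _ ≤ |v| * c := by
        gcongr
        exact (abs_le.2 ⟨(hw3 i).1, (hw3 i).2⟩).trans hc0
    _ ≤ (v * Z j i.succ) * c := by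
        gcongr
        exact hδ.le.trans hc0
    _ = v * (c * Z j i.succ) := by ring

lemma volume_real_euc_box {n : ℕ} (s : Fin n → Set ℝ) (hs : ∀ i, MeasurableSet (s i)) :
    (volume : Measure (Euc n)).real {x | ∀ i, x i ∈ s i} = ∏ i, (volume : Measure ℝ).real (s i) := by
  have h := (PiLp.volume_preserving_ofLp (Fin n)).measureReal_preimage
    (MeasurableSet.univ_pi hs).nullMeasurableSet
  rw [measureReal_def volume (Set.univ.pi s), volume_pi_pi, ENNReal.toReal_prod] at h
  refine Eq.trans ?_ h
  congr 1
  ext x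
  simp

lemma capBox_eq (k : ℕ) (a η δ : ℝ) : capBox k a η δ = {w | ∀ i, w i ∈
    (Fin.cons (Set.Icc a (a + η / 2)) fun _ => Set.Icc (-δ) δ : Fin (k + 1) → Set ℝ) i} := by
  ext w
  simp [capBox, Fin.forall_fin_succ]

lemma measurableSet_cons {k : ℕ} {s : Set ℝ} {t : Fin k → Set ℝ} (hs : MeasurableSet s)
    (ht : ∀ i, MeasurableSet (t i)) (i : Fin (k + 1)) :
    MeasurableSet ((Fin.cons s t : Fin (k + 1) → Set ℝ) i) := by
  refine Fin.cases ?_ (fun j => ?_) i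
  · simpa using hs
  · simpa using ht j

lemma measurableSet_euc_box {n : ℕ} {s : Fin n → Set ℝ} (hs : ∀ i, MeasurableSet (s i)) :
    MeasurableSet {x : Euc n | ∀ i, x i ∈ s i} := by
  rw [Set.ofPred_forall]
  exact MeasurableSet.iInter fun i => (by fun_prop : Measurable fun x : Euc n => x i) (hs i)

lemma measurableSet_capBox (k : ℕ) (a η δ : ℝ) : MeasurableSet (capBox k a η δ) := by
  rw [capBox_eq]
  exact measurableSet_euc_box (measurableSet_cons measurableSet_Icc fun _ => measurableSet_Icc)

lemma volume_capBox (k : ℕ) (a : ℝ) {η δ : ℝ} (hη : 0 ≤ η) (hδ : 0 ≤ δ) :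
    (volume : Measure (Euc (k + 1))).real (capBox k a η δ) = η / 2 * (2 * δ) ^ k := by
  rw [capBox_eq, volume_real_euc_box _
    (measurableSet_cons measurableSet_Icc fun _ => measurableSet_Icc), Fin.prod_univ_succ]
  simp only [Fin.cons_zero, Fin.cons_succ, Finset.prod_const, Finset.card_univ, Fintype.card_fin]
  rw [Real.volume_real_Icc_of_le (by linarith), Real.volume_real_Icc_of_le (by linarith)]
  ring

lemma convex_setOf_coord_lt {n : ℕ} (i : Fin n) (a : ℝ) : Convex ℝ {y : Euc n | y i < a} :=
  (convex_Iio a).is_linear_preimage (f := fun y : Euc n => y i)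
    ⟨fun _ _ => rfl, fun _ _ => rfl⟩

lemma le_gain_of_slabOrthants {m k : ℕ} {a h η t : ℝ} (hh : 0 ≤ h) (hη : 0 < η) (ht : a + η ≤ t)
    {Z : Fin m → Euc (k + 1)} (hZ : ∀ σ, ∃ j, Z j ∈ slabOrthant a h σ) (hZ' : ∀ j, Z j 0 < a) :
    hullVol Z + η / 2 * (η / (η + h)) ^ k ≤
      hullVol (Fin.cons (EuclideanSpace.single 0 t) Z : Fin (m + 1) → Euc (k + 1)) := by
  have h1 : η / 2 * (η / (η + h)) ^ k =
      (volume : Measure (Euc (k + 1))).real (capBox k a η (η / (2 * (η + h)))) := by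
    rw [volume_capBox k a hη.le (by positivity)]
    congr 2
    field_simp
  have h2 : Disjoint (convexHull ℝ (Set.range Z)) (capBox k a η (η / (2 * (η + h)))) := by
    refine Set.disjoint_left.2 fun y hy hy' => ?_
    have h3 : convexHull ℝ (Set.range Z) ⊆ {y : Euc (k + 1) | y 0 < a} := by
      refine convexHull_min ?_ (convex_setOf_coord_lt 0 a)
      rintro _ ⟨j, rfl⟩
      exact hZ' j
    exact (h3 hy : y 0 < a).not_ge hy'.1.1
  have hsub := capBox_subset_convexHull hh hη ht hZ
  have hfin : volume (convexHull ℝ (Set.range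
      (Fin.cons (EuclideanSpace.single 0 t) Z : Fin (m + 1) → Euc (k + 1)))) ≠ ⊤ :=
    (volume_hull_lt_top (Set.finite_range _)).ne
  rw [h1, hullVol, ← measureReal_union h2 (measurableSet_capBox _ _ _ _)
    (volume_hull_lt_top (Set.finite_range _)).ne ((measure_mono hsub).trans_lt hfin.lt_top).ne]
  refine measureReal_mono (Set.union_subset (convexHull_mono ?_) hsub) hfin
  rw [Fin.range_cons]
  exact Set.subset_insert _ _

/-! ### Expected gain for Gaussian points -/

/-- The law of `m` independent standard Gaussian points of `ℝ^d`. -/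
noncomputable abbrev gaussPi (m d : ℕ) : Measure (Fin m → Euc d) :=
  Measure.pi fun _ => stdGaussian (Euc d)

lemma gaussPi_real_forall_mem (m : ℕ) {d : ℕ} (S : Set (Euc d)) :
    (gaussPi m d).real {Z | ∀ i, Z i ∈ S} = (stdGaussian (Euc d)).real S ^ m := by
  have h : {Z : Fin m → Euc d | ∀ i, Z i ∈ S} = Set.univ.pi fun _ => S := by
    ext; simp
  rw [h, measureReal_def, Measure.pi_pi, Finset.prod_const, Finset.card_univ, Fintype.card_fin,
    ENNReal.toReal_pow]
  rfl

lemma measurableSet_forall_mem (m : ℕ) {d : ℕ} {S : Set (Euc d)} (hS : MeasurableSet S) :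
    MeasurableSet {Z : Fin m → Euc d | ∀ i, Z i ∈ S} := by
  rw [Set.ofPred_forall]
  exact MeasurableSet.iInter fun i => measurable_pi_apply i hS

lemma memLp_norm_pow_eval (m d k : ℕ) (i : Fin m) :
    MemLp (fun Z : Fin m → Euc d => ‖Z i‖ ^ k) 2 (gaussPi m d) :=
  (memLp_norm_pow_stdGaussian d k).comp_measurePreserving
    (measurePreserving_eval (fun _ => stdGaussian (Euc d)) i)

lemma memLp_const_add_sum_norm_pow (m d k : ℕ) (c : ℝ) :
    MemLp (fun Z : Fin m → Euc d => c + ∑ i, ‖Z i‖ ^ k) 2 (gaussPi m d) :=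
  (memLp_const c).add (memLp_finsetSum _ fun i _ => memLp_norm_pow_eval m d k i)

lemma integral_sq_one_add_sum_norm_pow_le (m d k : ℕ) :
    ∫ Z, (1 + ∑ i, ‖Z i‖ ^ k) ^ 2 ∂(gaussPi m d) ≤
      (m + 1) ^ 2 * (1 + ∫ x, (‖x‖ ^ k) ^ 2 ∂(stdGaussian (Euc d))) := by
  set M := ∫ x, (‖x‖ ^ k) ^ 2 ∂(stdGaussian (Euc d)) with hM
  have hM0 : 0 ≤ M := integral_nonneg fun x => by positivity
  have hi : ∀ i : Fin m, ∫ Z, (‖Z i‖ ^ k) ^ 2 ∂(gaussPi m d) = M := fun i => by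
    have h1 := (measurePreserving_eval (fun _ : Fin m => stdGaussian (Euc d)) i).map_eq
    rw [hM, ← h1, integral_map (measurable_pi_apply i).aemeasurable
      (Measurable.aestronglyMeasurable (by fun_prop))]
  have hint : ∀ i : Fin m, Integrable (fun Z => (‖Z i‖ ^ k) ^ 2) (gaussPi m d) := fun i =>
    (memLp_norm_pow_eval m d k i).integrable_sq
  have h1 : ∀ Z : Fin m → Euc d, (1 + ∑ i, ‖Z i‖ ^ k) ^ 2 ≤
      (m + 1) * (1 + ∑ i, (‖Z i‖ ^ k) ^ 2) := fun Z => by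
    have := sq_sum_le_card_mul_sum_sq (s := Finset.univ)
      (f := (Fin.cons 1 fun i => ‖Z i‖ ^ k : Fin (m + 1) → ℝ))
    simpa [Fin.sum_univ_succ] using this
  calc ∫ Z, (1 + ∑ i, ‖Z i‖ ^ k) ^ 2 ∂(gaussPi m d)
      ≤ ∫ Z, (m + 1) * (1 + ∑ i, (‖Z i‖ ^ k) ^ 2) ∂(gaussPi m d) :=
        integral_mono (memLp_const_add_sum_norm_pow m d k 1).integrable_sq
          (((integrable_const _).add (integrable_finsetSum _ fun i _ => hint i)).const_mul _) h1
    _ = (m + 1) * (1 + m * M) := by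
        rw [integral_const_mul, integral_add (integrable_const _)
          (integrable_finsetSum _ fun i _ => hint i), integral_finsetSum _ fun i _ => hint i]
        simp [hi]
    _ ≤ (m + 1) ^ 2 * (1 + M) := by
        have : (0 : ℝ) ≤ m := m.cast_nonneg
        nlinarith [mul_nonneg this hM0]

lemma measurable_fin_cons {m ℓ : ℕ} :
    Measurable fun q : Euc ℓ × (Fin m → Euc ℓ) => (Fin.cons q.1 q.2 : Fin (m + 1) → Euc ℓ) := by
  refine measurable_pi_lambda _ fun i => ?_
  refine Fin.cases ?_ (fun j => ?_) i
  · simpa using measurable_fst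
  · simpa [Function.comp_def] using (measurable_pi_apply j).comp (measurable_snd (α := Euc ℓ))

lemma measurable_hullVol_cons_right {m ℓ : ℕ} (z : Euc ℓ) : Measurable fun Z : Fin m → Euc ℓ =>
    hullVol (Fin.cons z Z : Fin (m + 1) → Euc ℓ) :=
  measurable_hullVol.comp (measurable_fin_cons.comp (f := fun Z => (z, Z)) measurable_prodMk_left)

/-- The volume of the unit ball of `ℝ^ℓ`. -/
noncomputable def unitBallVol (ℓ : ℕ) : ℝ := (volume : Measure (Euc ℓ)).real (Metric.ball 0 1)

lemma hullVol_cons_le {m ℓ : ℕ} (z : Euc ℓ) (Z : Fin m → Euc ℓ) :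
    hullVol (Fin.cons z Z : Fin (m + 1) → Euc ℓ) ≤
      unitBallVol ℓ * (‖z‖ ^ ℓ + ∑ i, ‖Z i‖ ^ ℓ) := by
  simpa [Fin.sum_univ_succ, unitBallVol] using hullVol_le (Fin.cons z Z : Fin (m + 1) → Euc ℓ)

lemma memLp_hullVol (m ℓ : ℕ) : MemLp (fun Z : Fin m → Euc ℓ => hullVol Z) 2 (gaussPi m ℓ) := by
  refine ((memLp_const_add_sum_norm_pow m ℓ ℓ 0).const_mul (unitBallVol ℓ)).mono'
    measurable_hullVol.aestronglyMeasurable (Eventually.of_forall fun Z => ?_)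
  rw [Real.norm_of_nonneg (hullVol_nonneg _), zero_add]
  exact hullVol_le Z

lemma memLp_hullVol_cons {m ℓ : ℕ} (z : Euc ℓ) :
    MemLp (fun Z : Fin m → Euc ℓ => hullVol (Fin.cons z Z : Fin (m + 1) → Euc ℓ)) 2
      (gaussPi m ℓ) := by
  refine ((memLp_const_add_sum_norm_pow m ℓ ℓ (‖z‖ ^ ℓ)).const_mul (unitBallVol ℓ)).mono'
    (measurable_hullVol_cons_right z).aestronglyMeasurable (Eventually.of_forall fun Z => ?_)
  rw [Real.norm_of_nonneg (hullVol_nonneg _)]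
  exact hullVol_cons_le z Z

/-- The expected volume gained by adding the point `z` to the hull of `m` Gaussian points. -/
noncomputable def expGain (m ℓ : ℕ) (z : Euc ℓ) : ℝ :=
  ∫ Z, (hullVol (Fin.cons z Z : Fin (m + 1) → Euc ℓ) - hullVol Z) ∂(gaussPi m ℓ)

lemma integrable_gain {m ℓ : ℕ} (z : Euc ℓ) :
    Integrable (fun Z => hullVol (Fin.cons z Z : Fin (m + 1) → Euc ℓ) - hullVol Z)
      (gaussPi m ℓ) :=
  ((memLp_hullVol_cons z).integrable one_le_two).sub ((memLp_hullVol m ℓ).integrable one_le_two)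

lemma expGain_nonneg (m ℓ : ℕ) (z : Euc ℓ) : 0 ≤ expGain m ℓ z :=
  integral_nonneg fun Z => sub_nonneg.2 (hullVol_le_cons z Z)

/-- The expected gain is rotation invariant. -/
lemma expGain_linearIsometryEquiv {m ℓ : ℕ} (T : Euc ℓ ≃ₗᵢ[ℝ] Euc ℓ) (z : Euc ℓ) :
    expGain m ℓ (T z) = expGain m ℓ z := by
  have h1 : MeasurePreserving T (stdGaussian (Euc ℓ)) (stdGaussian (Euc ℓ)) :=
    ⟨T.continuous.measurable, stdGaussian_map T⟩
  have h2 : MeasurePreserving (fun (Z : Fin m → Euc ℓ) i => T (Z i)) (gaussPi m ℓ) (gaussPi m ℓ) :=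
    measurePreserving_pi _ _ fun _ => h1
  unfold expGain
  conv_lhs => rw [← h2.map_eq]
  rw [integral_map h2.measurable.aemeasurable]
  · refine integral_congr_ae (Eventually.of_forall fun Z => ?_)
    have h3 : (Fin.cons (T z) fun i => T (Z i) : Fin (m + 1) → Euc ℓ) =
        fun i => T ((Fin.cons z Z : Fin (m + 1) → Euc ℓ) i) := by
      ext1 i
      refine Fin.cases ?_ (fun j => ?_) i <;> simp
    change hullVol _ - hullVol _ = hullVol _ - hullVol _
    rw [h3, hullVol_comp_linearIsometryEquiv, hullVol_comp_linearIsometryEquiv]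
  · exact ((measurable_hullVol_cons_right _).sub measurable_hullVol).aestronglyMeasurable

lemma expGain_eq_single {m k : ℕ} (z : Euc (k + 1)) :
    expGain m (k + 1) z = expGain m (k + 1) (EuclideanSpace.single 0 ‖z‖) := by
  have h : ‖z‖ = ‖(EuclideanSpace.single 0 ‖z‖ : Euc (k + 1))‖ := by simp
  rw [← Submodule.reflection_sub h, expGain_linearIsometryEquiv]

lemma measurableSet_orthant {n : ℕ} (σ : Fin n → Bool) : MeasurableSet (orthant σ) :=
  measurableSet_euc_box (s := fun i => {y | 1 ≤ boolSign (σ i) * y}) fun i =>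
    measurableSet_le measurable_const (by fun_prop)

lemma stdGaussian_orthant {n : ℕ} (σ : Fin n → Bool) :
    (stdGaussian (Euc n)).real (orthant σ) = (gaussianReal 0 1).real (Set.Ici 1) ^ n := by
  have h := stdGaussian_real_box (fun i => {y | 1 ≤ boolSign (σ i) * y}) fun i =>
    measurableSet_le measurable_const (by fun_prop)
  refine h.trans ?_
  simp [gaussianReal_le_mul_sign 1 (boolSign_eq _)]

/-- A point of the unit ball lies in the hull of the sample unless some orthant is missed, which
has exponentially small probability. -/
lemma exists_expGain_le (ℓ : ℕ) : ∃ C ρ : ℝ, 0 < C ∧ 0 < ρ ∧ ρ < 1 ∧ ∀ (m : ℕ) (z : Euc ℓ),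
    ‖z‖ ≤ 1 → expGain m ℓ z ≤ C * (m + 1) ^ 2 * ρ ^ m := by
  set p : ℝ := (gaussianReal 0 1).real (Set.Ici 1) ^ ℓ with hp
  have hp0 : 0 < p := pow_pos (gaussianReal_Ici_pos 1) _
  have hp1 : p ≤ 1 := pow_le_one₀ measureReal_nonneg measureReal_le_one
  set M := ∫ x, (‖x‖ ^ ℓ) ^ 2 ∂(stdGaussian (Euc ℓ)) with hM
  have hM0 : 0 ≤ M := integral_nonneg fun x => by positivity
  set κ := unitBallVol ℓ with hκ
  have hκ0 : 0 ≤ κ := measureReal_nonneg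
  -- `1 - p / 2` instead of `1 - p` keeps `ρ` positive when `p = 1`, that is for `ℓ = 0`.
  set ρ := √(1 - p / 2) with hρ
  have hρ2 : ρ * ρ = 1 - p / 2 := Real.mul_self_sqrt (by linarith)
  have hρ0 : 0 < ρ := Real.sqrt_pos.2 (by linarith)
  refine ⟨κ ^ 2 * (1 + M) + 2 ^ ℓ, ρ, by positivity, hρ0, by nlinarith, fun m z hz => ?_⟩
  set f : (Fin m → Euc ℓ) → ℝ := fun Z => κ * (1 + ∑ i, ‖Z i‖ ^ ℓ) with hf
  have hf0 : ∀ Z, 0 ≤ f Z := fun Z => by positivity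
  set miss : (Fin ℓ → Bool) → Set (Fin m → Euc ℓ) := fun σ => {Z | ∀ i, Z i ∈ (orthant σ)ᶜ}
    with hmiss
  have hmm : ∀ σ, MeasurableSet (miss σ) := fun σ =>
    measurableSet_forall_mem m (measurableSet_orthant σ).compl
  have hmp : ∀ σ, (gaussPi m ℓ).real (miss σ) ≤ (ρ * ρ) ^ m := fun σ => by
    rw [hmiss, gaussPi_real_forall_mem, probReal_compl_eq_one_sub (measurableSet_orthant σ),
      stdGaussian_orthant, hρ2]
    exact pow_le_pow_left₀ (by linarith) (by linarith) _
  set ε := ρ ^ m with hε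
  have hε0 : 0 < ε := by positivity
  -- On the bad event `f ≤ ε f² + 1 / ε`, which separates the moments of `f` from its probability.
  have hpt : ∀ Z : Fin m → Euc ℓ, hullVol (Fin.cons z Z : Fin (m + 1) → Euc ℓ) - hullVol Z ≤
      ε * f Z ^ 2 + ε⁻¹ * ∑ σ, (miss σ).indicator 1 Z := fun Z => by
    have hn : ∀ σ, 0 ≤ (miss σ).indicator (1 : (Fin m → Euc ℓ) → ℝ) Z := fun σ =>
      Set.indicator_nonneg (fun _ _ => zero_le_one) _
    by_cases hb : ∃ σ, Z ∈ miss σ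
    · obtain ⟨σ, hσ⟩ := hb
      have h1 : 1 ≤ ∑ σ, (miss σ).indicator (1 : (Fin m → Euc ℓ) → ℝ) Z := by
        refine le_trans ?_ (Finset.single_le_sum (f := fun σ => (miss σ).indicator (1 : (Fin m → Euc ℓ) → ℝ) Z)
          (fun σ _ => hn σ) (Finset.mem_univ σ))
        simp [hσ]
      have h2 : hullVol (Fin.cons z Z : Fin (m + 1) → Euc ℓ) ≤ f Z := by
        refine (hullVol_cons_le z Z).trans ?_
        simp only [hf]
        gcongr
        exact pow_le_one₀ (norm_nonneg _) hz
      have h3 : f Z ≤ ε * f Z ^ 2 + ε⁻¹ := by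
        have h4 : 0 ≤ ε⁻¹ * ((ε * f Z - 1) ^ 2 + ε * f Z) := by
          have := hf0 Z
          positivity
        have h5 : ε⁻¹ * ((ε * f Z - 1) ^ 2 + ε * f Z) = ε * f Z ^ 2 + ε⁻¹ - f Z := by
          field_simp
          ring
        linarith
      have h6 := mul_le_mul_of_nonneg_left h1 (inv_pos.2 hε0).le
      linarith [hullVol_nonneg Z]
    · have h1 : ∀ σ, ∃ j, Z j ∈ orthant σ := by
        intro σ
        by_contra hc
        exact hb ⟨σ, fun i hi => hc ⟨i, hi⟩⟩
      rw [hullVol_cons_of_mem (mem_convexHull_of_orthants hz h1), sub_self]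
      have := Finset.sum_nonneg fun σ (_ : σ ∈ Finset.univ) => hn σ
      positivity
  have hi1 : Integrable (fun Z => ε * f Z ^ 2) (gaussPi m ℓ) :=
    ((memLp_const_add_sum_norm_pow m ℓ ℓ 1).const_mul κ).integrable_sq.const_mul ε
  have hi2 : ∀ σ, Integrable ((miss σ).indicator (1 : (Fin m → Euc ℓ) → ℝ)) (gaussPi m ℓ) := fun σ =>
    (integrable_const (1 : ℝ)).indicator (hmm σ)
  have hi3 : Integrable (fun Z => ∑ σ, (miss σ).indicator (1 : (Fin m → Euc ℓ) → ℝ) Z) (gaussPi m ℓ) :=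
    integrable_finsetSum _ fun σ _ => hi2 σ
  calc expGain m ℓ z
      ≤ ∫ Z, (ε * f Z ^ 2 + ε⁻¹ * ∑ σ, (miss σ).indicator 1 Z) ∂(gaussPi m ℓ) :=
        integral_mono (integrable_gain z) (hi1.add (hi3.const_mul _)) hpt
    _ = ε * (κ ^ 2 * ∫ Z, (1 + ∑ i, ‖Z i‖ ^ ℓ) ^ 2 ∂(gaussPi m ℓ)) +
          ε⁻¹ * ∑ σ, (gaussPi m ℓ).real (miss σ) := by
        rw [integral_add hi1 (hi3.const_mul _), integral_const_mul, integral_const_mul,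
          integral_finsetSum _ fun σ _ => hi2 σ]
        simp only [hf, mul_pow, integral_const_mul, integral_indicator_one (hmm _)]
    _ ≤ ε * (κ ^ 2 * ((m + 1) ^ 2 * (1 + M))) + ε⁻¹ * ∑ _σ : Fin ℓ → Bool, (ρ * ρ) ^ m := by
        gcongr
        · exact integral_sq_one_add_sum_norm_pow_le m ℓ ℓ
        · exact hmp _
    _ = (κ ^ 2 * (1 + M) * (m + 1) ^ 2 + 2 ^ ℓ) * ρ ^ m := by
        simp only [Finset.sum_const, Finset.card_univ, Fintype.card_fun, Fintype.card_bool,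
          Fintype.card_fin, nsmul_eq_mul, mul_pow, ← hε]
        push_cast
        field_simp
    _ ≤ _ := by
        gcongr
        have : (1 : ℝ) ≤ (m + 1) ^ 2 := one_le_pow₀ (by linarith [(m.cast_nonneg : (0 : ℝ) ≤ m)])
        nlinarith [pow_pos (two_pos : (0 : ℝ) < 2) ℓ]

lemma slabOrthant_eq {k : ℕ} (a h : ℝ) (σ : Fin k → Bool) : slabOrthant a h σ = {y | ∀ i, y i ∈
    (Fin.cons (Set.Ico (a - h) a) fun i => {y | 1 ≤ boolSign (σ i) * y} :
      Fin (k + 1) → Set ℝ) i} := by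
  ext w
  simp [slabOrthant, Fin.forall_fin_succ]

lemma measurableSet_slabOrthant {k : ℕ} (a h : ℝ) (σ : Fin k → Bool) :
    MeasurableSet (slabOrthant a h σ) := by
  rw [slabOrthant_eq]
  exact measurableSet_euc_box (measurableSet_cons measurableSet_Ico fun i =>
    measurableSet_le measurable_const (by fun_prop))

lemma stdGaussian_slabOrthant {k : ℕ} (a h : ℝ) (σ : Fin k → Bool) :
    (stdGaussian (Euc (k + 1))).real (slabOrthant a h σ) =
      (gaussianReal 0 1).real (Set.Ico (a - h) a) *
        (gaussianReal 0 1).real (Set.Ici 1) ^ k := by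
  rw [slabOrthant_eq, stdGaussian_real_box _ (measurableSet_cons measurableSet_Ico fun i =>
    measurableSet_le measurable_const (by fun_prop)), Fin.prod_univ_succ]
  simp only [Fin.cons_zero, Fin.cons_succ]
  simp [gaussianReal_le_mul_sign 1 (boolSign_eq _)]

lemma measurableSet_coord_lt {k : ℕ} (a : ℝ) : MeasurableSet {y : Euc (k + 1) | y 0 < a} :=
  measurableSet_lt (by fun_prop) measurable_const

lemma stdGaussian_coord_lt {k : ℕ} (a : ℝ) :
    (stdGaussian (Euc (k + 1))).real {y | y 0 < a} = 1 - (gaussianReal 0 1).real (Set.Ici a) := by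
  have h := stdGaussian_real_box (Fin.cons (Set.Iio a) fun _ => Set.univ : Fin (k + 1) → Set ℝ)
    (measurableSet_cons measurableSet_Iio fun _ => MeasurableSet.univ)
  rw [Fin.prod_univ_succ] at h
  simp only [Fin.forall_fin_succ, Fin.cons_zero, Fin.cons_succ, Set.mem_univ, implies_true,
    and_true, probReal_univ, Finset.prod_const_one, mul_one, Set.mem_Iio] at h
  rw [h, ← probReal_compl_eq_one_sub measurableSet_Ici, Set.compl_Ici]

/-- The probability that all points stay below the height `a` while every slab orthant is hit. -/
lemma le_gaussPi_slabOrthants (m k : ℕ) (a h : ℝ) {p₀ p : ℝ}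
    (hp₀ : (gaussianReal 0 1).real (Set.Ici a) = p₀)
    (hp : (gaussianReal 0 1).real (Set.Ico (a - h) a) *
      (gaussianReal 0 1).real (Set.Ici 1) ^ k = p) :
    (1 - p₀) ^ m * (1 - 2 ^ k * (1 - p) ^ m) ≤ (gaussPi m (k + 1)).real
      ({Z | ∀ j, Z j ∈ {y : Euc (k + 1) | y 0 < a}} \
        ⋃ σ : Fin k → Bool, {Z | ∀ j, Z j ∈ {y : Euc (k + 1) | y 0 < a} \ slabOrthant a h σ}) := by
  have h1 : ∀ σ : Fin k → Bool, (gaussPi m (k + 1)).real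
      {Z | ∀ j, Z j ∈ {y : Euc (k + 1) | y 0 < a} \ slabOrthant a h σ} ≤
      (1 - p₀) ^ m * (1 - p) ^ m := fun σ => by
    rw [gaussPi_real_forall_mem, ← mul_pow]
    refine pow_le_pow_left₀ measureReal_nonneg ?_ _
    have hsub : slabOrthant a h σ ⊆ {y : Euc (k + 1) | y 0 < a} := fun y hy => hy.1.2
    rw [measureReal_sdiff hsub (measurableSet_slabOrthant a h σ),
      stdGaussian_coord_lt, stdGaussian_slabOrthant, hp₀, hp]
    have h2 : 0 ≤ p₀ := hp₀ ▸ measureReal_nonneg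
    have h3 : 0 ≤ p := hp ▸ by positivity
    nlinarith [mul_nonneg h2 h3]
  refine le_trans ?_ le_measureReal_sdiff
  rw [gaussPi_real_forall_mem, stdGaussian_coord_lt, hp₀, mul_sub, mul_one]
  gcongr
  refine (measureReal_iUnion_fintype_le _).trans ((Finset.sum_le_sum fun σ _ => h1 σ).trans_eq ?_)
  simp only [Finset.sum_const, Finset.card_univ, Fintype.card_fun, Fintype.card_bool,
    Fintype.card_fin, nsmul_eq_mul]
  push_cast
  ring

lemma exp_neg_two_mul_le_one_sub {x : ℝ} (h0 : 0 ≤ x) (h1 : x ≤ 1 / 2) :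
    Real.exp (-(2 * x)) ≤ 1 - x := by
  have h2 := Real.add_one_le_exp (2 * x)
  rw [Real.exp_neg, inv_le_comm₀ (Real.exp_pos _) (by linarith)]
  refine le_trans ?_ h2
  rw [inv_le_iff_one_le_mul₀ (by linarith)]
  nlinarith

/-- With `R exp (R²/2) = n`, the half-space at height `R - 1/R` contains on average a bounded number
of the points, and slab orthants of thickness a large multiple of `1/R` below it contain as many as
desired. Hence with probability bounded below the half-space is empty and each slab orthant is hit,
and then adding a point of norm at least `R` gains a volume of order `1/R`. -/
lemma exists_le_expGain (k : ℕ) : ∃ c R₀ : ℝ, 0 < c ∧ ∀ R, R₀ ≤ R → ∀ m : ℕ,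
    (m + 1 : ℝ) = R * Real.exp (R ^ 2 / 2) → ∀ z : Euc (k + 1), R ≤ ‖z‖ →
      c / R ≤ expGain m (k + 1) z := by
  set θ : ℝ := (gaussianReal 0 1).real (Set.Ici 1) ^ k with hθ
  have hθ0 : 0 < θ := pow_pos (gaussianReal_Ici_pos 1) _
  set b : ℝ := (√(2 * Real.pi))⁻¹ * θ with hb
  have hb0 : 0 < b := by positivity
  -- Hitting an orthant `Λ` times on average makes the union bound over `2 ^ k` orthants `1 / 2`.
  set Λ : ℝ := Real.log (2 ^ (k + 1)) with hΛ
  have hΛ0 : 0 ≤ Λ := Real.log_nonneg (one_le_pow₀ one_le_two)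
  set K : ℝ := 1 + 2 * Λ / b with hK
  have hK1 : 1 ≤ K := by
    have : 0 ≤ 2 * Λ / b := by positivity
    linarith
  refine ⟨Real.exp (-12) / 2 * (1 / 2 * (1 / K) ^ k), max 12 K, by positivity,
    fun R hR m hm z hz => ?_⟩
  have hR12 : 12 ≤ R := (le_max_left _ _).trans hR
  have hRK : K ≤ R := (le_max_right _ _).trans hR
  have hR0 : 0 < R := by linarith
  set n : ℝ := m + 1 with hn
  have hnR : R ≤ n := by
    rw [hm]
    exact le_mul_of_one_le_right hR0.le (Real.one_le_exp (by positivity))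
  have hn0 : 0 < n := by linarith
  set a : ℝ := R - 1 / R with ha
  set h : ℝ := (K - 1) / R with hh
  have hh0 : 0 ≤ h := div_nonneg (by linarith) hR0.le
  have hRinv : 1 / R ≤ 1 := by
    rw [div_le_one hR0]; linarith
  have ha1 : R / 2 ≤ a := by linarith
  have haR : a ≤ R := by
    have : 0 < 1 / R := by positivity
    linarith
  have ha0 : 0 < a := by linarith
  have hψ : Real.exp (-(1 / 2) * R ^ 2) / R = 1 / n := by
    rw [hm, show -(1 / 2) * R ^ 2 = -(R ^ 2 / 2) by ring, Real.exp_neg]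
    field_simp
  -- The half-space `{y₀ ≥ a}` has probability at most `6 / n`.
  set p₀ := (gaussianReal 0 1).real (Set.Ici a) with hp₀
  have hp₀n : p₀ ≤ 6 / n := by
    have h1 : -(1 / 2) * a ^ 2 ≤ 1 + -(1 / 2) * R ^ 2 := by
      have : a ^ 2 = R ^ 2 - 2 + (1 / R) ^ 2 := by
        rw [ha]; field_simp; ring
      nlinarith [sq_nonneg (1 / R)]
    have he : Real.exp 1 ≤ 3 := Real.exp_one_lt_three.le
    calc p₀ ≤ Real.exp (-(1 / 2) * a ^ 2) / a := gaussianReal_Ici_le ha0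
      _ ≤ Real.exp (1 + -(1 / 2) * R ^ 2) / (R / 2) := by gcongr
      _ = 2 * Real.exp 1 * (Real.exp (-(1 / 2) * R ^ 2) / R) := by
          rw [Real.exp_add]; field_simp
      _ ≤ 2 * 3 * (1 / n) := by rw [hψ]; gcongr
      _ = 6 / n := by ring
  -- Each slab orthant has probability at least `2 Λ / n`.
  set p := (gaussianReal 0 1).real (Set.Ico (a - h) a) * θ with hp
  have hpn : 2 * Λ / n ≤ p := by
    have h0 : 0 ≤ a - h := by
      have : a - h = R - K / R := by rw [ha, hh]; ring
      rw [this, sub_nonneg, div_le_iff₀ hR0]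
      nlinarith
    have h1 := le_gaussianReal_Ico h0 (by linarith : a - h ≤ a)
    have h2 : h * ((√(2 * Real.pi))⁻¹ * Real.exp (-(1 / 2) * R ^ 2)) ≤
        (gaussianReal 0 1).real (Set.Ico (a - h) a) := by
      refine le_trans ?_ h1
      rw [sub_sub_cancel]
      gcongr h * ((√(2 * Real.pi))⁻¹ * Real.exp ?_)
      nlinarith
    have h3 : 2 * Λ / n = h * ((√(2 * Real.pi))⁻¹ * Real.exp (-(1 / 2) * R ^ 2)) * θ := by
      have h4 : h = 2 * Λ / b / R := by rw [hh, hK]; ring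
      calc 2 * Λ / n = 2 * Λ * (1 / n) := by ring
        _ = 2 * Λ * (Real.exp (-(1 / 2) * R ^ 2) / R) := by rw [hψ]
        _ = _ := by
          rw [h4, hb]
          field_simp
    rw [h3, hp]
    exact mul_le_mul_of_nonneg_right h2 hθ0.le
  have hp1 : p ≤ 1 := mul_le_one₀ measureReal_le_one hθ0.le
    (pow_le_one₀ measureReal_nonneg measureReal_le_one)
  have hm2 : n / 2 ≤ m := by
    have : (m : ℝ) = n - 1 := by rw [hn]; ring
    linarith
  have hmn : (m : ℝ) ≤ n := by rw [hn]; linarith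
  have hq1 : Real.exp (-12) ≤ (1 - p₀) ^ m := by
    have h6 : 6 / n ≤ 1 / 2 := by
      rw [div_le_div_iff₀ hn0 two_pos]; linarith
    calc Real.exp (-12) ≤ Real.exp (-(2 * (6 / n))) ^ m := by
          rw [← Real.exp_nat_mul]
          gcongr
          have : (m : ℝ) * (6 / n) ≤ 6 := by
            rw [← mul_div_assoc, div_le_iff₀ hn0]; linarith
          linarith
      _ ≤ (1 - 6 / n) ^ m := by
          gcongr
          exact exp_neg_two_mul_le_one_sub (by positivity) h6
      _ ≤ (1 - p₀) ^ m := by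
          gcongr
          linarith
  have hq2 : 2 ^ k * (1 - p) ^ m ≤ 1 / 2 := by
    have h1 : (1 - p) ^ m ≤ Real.exp (-Λ) := by
      calc (1 - p) ^ m ≤ Real.exp (-p) ^ m := by
            exact pow_le_pow_left₀ (by linarith) (Real.one_sub_le_exp_neg p) _
        _ = Real.exp (-(m * p)) := by rw [← Real.exp_nat_mul]; ring_nf
        _ ≤ Real.exp (-Λ) := by
            gcongr
            calc Λ = n / 2 * (2 * Λ / n) := by field_simp
              _ ≤ m * p := by gcongr
    have h2 : Real.exp (-Λ) = (2 ^ (k + 1))⁻¹ := by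
      rw [Real.exp_neg, hΛ, Real.exp_log (by positivity)]
    calc (2 : ℝ) ^ k * (1 - p) ^ m ≤ 2 ^ k * (2 ^ (k + 1))⁻¹ := by rw [← h2]; gcongr
      _ = 1 / 2 := by rw [pow_succ]; field_simp
  set good : Set (Fin m → Euc (k + 1)) := {Z | ∀ j, Z j ∈ {y : Euc (k + 1) | y 0 < a}} \
    ⋃ σ : Fin k → Bool, {Z | ∀ j, Z j ∈ {y : Euc (k + 1) | y 0 < a} \ slabOrthant a h σ} with hgood
  have hgm : MeasurableSet good :=
    (measurableSet_forall_mem m (measurableSet_coord_lt a)).diff (MeasurableSet.iUnion fun σ =>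
      measurableSet_forall_mem m ((measurableSet_coord_lt a).diff (measurableSet_slabOrthant a h σ)))
  have hgp : Real.exp (-12) / 2 ≤ (gaussPi m (k + 1)).real good := by
    refine le_trans ?_ (le_gaussPi_slabOrthants m k a h hp₀.symm hp.symm)
    calc Real.exp (-12) / 2 = Real.exp (-12) * (1 - 1 / 2) := by ring
      _ ≤ _ := mul_le_mul hq1 (by linarith) (by norm_num) ((Real.exp_pos _).le.trans hq1)
  set v : ℝ := 1 / R / 2 * (1 / R / (1 / R + h)) ^ k with hv
  have hv1 : v = 1 / 2 * (1 / K) ^ k / R := by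
    have : 1 / R / (1 / R + h) = 1 / K := by
      rw [hh, ← add_div, div_div_div_cancel_right₀ hR0.ne']
      congr 1; ring
    rw [hv, this]; ring
  have hpt : ∀ Z, good.indicator (fun _ => v) Z ≤
      hullVol (Fin.cons (EuclideanSpace.single 0 ‖z‖) Z : Fin (m + 1) → Euc (k + 1)) -
        hullVol Z := fun Z => by
    by_cases hZ : Z ∈ good
    · rw [Set.indicator_of_mem hZ, hv]
      have h1 : ∀ j, Z j 0 < a := hZ.1
      have h2 : ∀ σ, ∃ j, Z j ∈ slabOrthant a h σ := by
        intro σ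
        by_contra hc
        exact hZ.2 (Set.mem_iUnion.2 ⟨σ, fun j => ⟨h1 j, fun hj => hc ⟨j, hj⟩⟩⟩)
      have := le_gain_of_slabOrthants hh0 (by positivity : 0 < 1 / R)
        (by rw [ha]; linarith : a + 1 / R ≤ ‖z‖) h2 h1
      linarith
    · rw [Set.indicator_of_notMem hZ]
      exact sub_nonneg.2 (hullVol_le_cons _ Z)
  rw [expGain_eq_single]
  calc Real.exp (-12) / 2 * (1 / 2 * (1 / K) ^ k) / R = Real.exp (-12) / 2 * v := by
        rw [hv1]; ring
    _ ≤ (gaussPi m (k + 1)).real good * v := by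
        gcongr
    _ = ∫ Z, good.indicator (fun _ => v) Z ∂(gaussPi m (k + 1)) := by
        rw [integral_indicator_const _ hgm, smul_eq_mul]
    _ ≤ _ := integral_mono ((integrable_const v).indicator hgm) (integrable_gain _) hpt

/-! ### Gaussian measure of thin shells -/

lemma pow_succ_sub_pow_succ_le {a b : ℝ} (ha : 0 ≤ a) (hab : a ≤ b) (D : ℕ) :
    b ^ (D + 1) - a ^ (D + 1) ≤ (b - a) * ((D + 1) * b ^ D) := by
  have h := abs_pow_sub_pow_le b a (D + 1)
  rw [abs_of_nonneg (sub_nonneg.2 (pow_le_pow_left₀ ha hab _)), abs_of_nonneg (sub_nonneg.2 hab),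
    abs_of_nonneg ha, abs_of_nonneg (ha.trans hab), max_eq_left hab, Nat.add_sub_cancel] at h
  push_cast at h
  linarith

lemma exists_stdGaussian_shell_le (D : ℕ) : ∃ C : ℝ, 0 < C ∧ ∀ R, 1 ≤ R →
    (stdGaussian (Euc (D + 1))).real (shell (D + 1) R (R + 1 / R)) ≤
      C * R ^ D / (R * Real.exp (R ^ 2 / 2)) := by
  have hg := gaussConst_pos (D + 1)
  have hκ := volume_ball_one_pos (D + 1)
  set κ := (volume : Measure (Euc (D + 1))).real (Metric.ball 0 1) with hκd
  refine ⟨gaussConst (D + 1) * κ * ((D + 1) * 2 ^ D), by positivity, fun R hR => ?_⟩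
  have hR0 : 0 < R := by linarith
  have hRinv : 1 / R ≤ R := by rw [div_le_iff₀ hR0]; nlinarith
  have hRi : 0 < 1 / R := by positivity
  refine (stdGaussian_real_le (measurableSet_shell _ _ _) (volume_shell_ne_top _ _ _) hR0.le
    fun x hx => hx.1).trans ?_
  rw [volume_shell D.succ_pos hR0.le (by linarith)]
  have h1 := pow_succ_sub_pow_succ_le hR0.le (by linarith : R ≤ R + 1 / R) D
  calc gaussConst (D + 1) * Real.exp (-(1 / 2) * R ^ 2) *
        (κ * ((R + 1 / R) ^ (D + 1) - R ^ (D + 1)))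
      ≤ gaussConst (D + 1) * Real.exp (-(1 / 2) * R ^ 2) *
        (κ * ((1 / R) * ((D + 1) * (2 * R) ^ D))) := by
        gcongr
        refine h1.trans ?_
        rw [add_sub_cancel_left]
        gcongr
        linarith
    _ = _ := by
        rw [show -(1 / 2) * R ^ 2 = -(R ^ 2 / 2) by ring, Real.exp_neg, mul_pow]
        field_simp

lemma norm_sq_eq_coordMap_add {ℓ e : ℕ} (x : Euc (ℓ + e)) :
    ‖x‖ ^ 2 = ‖coordMap (Nat.le_add_right ℓ e) x‖ ^ 2 + ∑ j : Fin e, x (Fin.natAdd ℓ j) ^ 2 := by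
  simp only [EuclideanSpace.norm_sq_eq, Fin.sum_univ_add, Real.norm_eq_abs, sq_abs]
  rfl

/-- The points of a thin shell whose projection also reaches norm `R` occupy, in terms of
`n = R exp (R²/2)`, at least the order `R^(ℓ-1) / n` of Gaussian mass, `ℓ = k + 1`: the projection
may vary in a thin shell of `ℝ^ℓ` while the other coordinates stay bounded. -/
lemma exists_le_stdGaussian_shell (k e : ℕ) : ∃ c : ℝ, 0 < c ∧ ∀ R, 1 ≤ R →
    c * R ^ k / (R * Real.exp (R ^ 2 / 2)) ≤ (stdGaussian (Euc (k + 1 + e))).real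
      {x | R ≤ ‖coordMap (Nat.le_add_right (k + 1) e) x‖ ∧ ‖x‖ ≤ R + 1 / R} := by
  have hg := gaussConst_pos (k + 1)
  have hκ := volume_ball_one_pos (k + 1)
  set κ := (volume : Measure (Euc (k + 1))).real (Metric.ball 0 1) with hκd
  set v : ℝ := 1 / (2 * (e + 1)) with hv
  have hv0 : 0 < v := by positivity
  set w : ℝ := (gaussianReal 0 1).real (Set.Ico 0 v) with hw
  have hw0 : 0 < w := lt_of_lt_of_le (by rw [sub_zero]; positivity) (le_gaussianReal_Ico le_rfl hv0.le)
  refine ⟨gaussConst (k + 1) * Real.exp (-1) * κ / 2 * w ^ e, by positivity, fun R hR => ?_⟩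
  have hR0 : 0 < R := by linarith
  set η : ℝ := 1 / (2 * R) with hη
  have hη0 : 0 < η := by positivity
  have hηR : η * R = 1 / 2 := by rw [hη]; field_simp
  have hη1 : η ≤ 1 / 2 := by nlinarith
  have h2η : 1 / R = 2 * η := by rw [hη]; field_simp
  have h1 : gaussConst (k + 1) * Real.exp (-1) * κ / 2 * w ^ e * R ^ k /
      (R * Real.exp (R ^ 2 / 2)) ≤
      (stdGaussian (Euc (k + 1))).real (shell (k + 1) R (R + η)) * w ^ e := by
    have h2 := le_stdGaussian_real (measurableSet_shell (k + 1) R (R + η)) fun x hx => hx.2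
    rw [volume_shell k.succ_pos hR0.le (by linarith)] at h2
    have h3 : η * R ^ k ≤ (R + η) ^ (k + 1) - R ^ (k + 1) := by
      have : (R + η) ^ (k + 1) ≥ (R + η) * R ^ k := by
        rw [pow_succ, mul_comm]
        gcongr
        linarith
      rw [pow_succ R k]
      linarith
    have h4 : -1 + -(R ^ 2 / 2) ≤ -(1 / 2) * (R + η) ^ 2 := by nlinarith
    calc gaussConst (k + 1) * Real.exp (-1) * κ / 2 * w ^ e * R ^ k / (R * Real.exp (R ^ 2 / 2))
        = gaussConst (k + 1) * Real.exp (-1 + -(R ^ 2 / 2)) * (κ * (η * R ^ k)) * w ^ e := by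
          rw [Real.exp_add, Real.exp_neg (R ^ 2 / 2), hη]
          field_simp
      _ ≤ gaussConst (k + 1) * Real.exp (-(1 / 2) * (R + η) ^ 2) *
            (κ * ((R + η) ^ (k + 1) - R ^ (k + 1))) * w ^ e := by
          gcongr
      _ ≤ _ := by gcongr
  refine h1.trans ?_
  rw [hw, ← stdGaussian_real_split (measurableSet_shell (k + 1) R (R + η)) measurableSet_Ico]
  refine measureReal_mono ?_ (measure_ne_top _ _)
  rintro x ⟨hx1, hx2⟩
  refine ⟨hx1.1, ?_⟩
  refine le_of_sq_le_sq ?_ (by positivity)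
  rw [norm_sq_eq_coordMap_add, h2η]
  have h5 : ∑ j : Fin e, x (Fin.natAdd (k + 1) j) ^ 2 ≤ 1 / 4 := by
    have h6 : ∀ j : Fin e, x (Fin.natAdd (k + 1) j) ^ 2 ≤ v ^ 2 := fun j =>
      pow_le_pow_left₀ (hx2 j).1 (hx2 j).2.le 2
    refine (Finset.sum_le_sum fun j _ => h6 j).trans ?_
    simp only [Finset.sum_const, Finset.card_univ, Fintype.card_fin, nsmul_eq_mul]
    have h7 : v * (2 * (e + 1)) = 1 := by rw [hv]; field_simp
    have h8 : (0 : ℝ) ≤ e := e.cast_nonneg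
    nlinarith [sq_nonneg v]
  have h9 : ‖coordMap (Nat.le_add_right (k + 1) e) x‖ ^ 2 ≤ (R + η) ^ 2 :=
    pow_le_pow_left₀ (norm_nonneg _) hx1.2 2
  nlinarith

lemma stdGaussian_closedBall_pos (d : ℕ) :
    0 < (stdGaussian (Euc d)).real (Metric.closedBall 0 1) := by
  have h := le_stdGaussian_real (d := d) (Metric.isClosed_closedBall (x := 0) (ε := 1)).measurableSet
    (R := 1) (fun x hx => by simpa using hx)
  refine lt_of_lt_of_le ?_ h
  have h1 : 0 < (volume : Measure (Euc d)).real (Metric.closedBall 0 1) :=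
    (volume_ball_one_pos d).trans_le
      (measureReal_mono Metric.ball_subset_closedBall measure_closedBall_lt_top.ne)
  have := gaussConst_pos d
  positivity

/-! ### Covariance with a linear statistic -/

/-- Cauchy–Schwarz in dual form: expand `0 ≤ ∫ (F - ∫ F - t S)²`. -/
lemma two_mul_sub_le_variance {Ω : Type*} [MeasurableSpace Ω] {μ : Measure Ω}
    [IsProbabilityMeasure μ] {F S : Ω → ℝ} (hF : MemLp F 2 μ) (hS : MemLp S 2 μ)
    (hS0 : ∫ ω, S ω ∂μ = 0) (t : ℝ) :
    2 * t * ∫ ω, F ω * S ω ∂μ - t ^ 2 * ∫ ω, S ω ^ 2 ∂μ ≤ Var[F; μ] := by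
  set a := ∫ ω, F ω ∂μ with ha
  have hG : MemLp (fun ω => F ω - a) 2 μ := hF.sub (memLp_const a)
  have hFS : Integrable (fun ω => F ω * S ω) μ := hF.integrable_mul hS
  have hSi : Integrable S μ := hS.integrable one_le_two
  have h1 : 0 ≤ ∫ ω, (F ω - a - t * S ω) ^ 2 ∂μ := integral_nonneg fun ω => sq_nonneg _
  have h2 : ∫ ω, (F ω - a - t * S ω) ^ 2 ∂μ =
      ∫ ω, (F ω - a) ^ 2 ∂μ - 2 * t * ∫ ω, F ω * S ω ∂μ + t ^ 2 * ∫ ω, S ω ^ 2 ∂μ := by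
    have h3 : ∀ ω, (F ω - a - t * S ω) ^ 2 =
        (F ω - a) ^ 2 - 2 * t * (F ω * S ω) + (2 * t * a) * S ω + t ^ 2 * S ω ^ 2 := fun ω => by
      ring
    have i1 : Integrable (fun ω => (F ω - a) ^ 2) μ := hG.integrable_sq
    have i2 : Integrable (fun ω => 2 * t * (F ω * S ω)) μ := hFS.const_mul _
    have i3 : Integrable (fun ω => 2 * t * a * S ω) μ := hSi.const_mul _
    have i4 : Integrable (fun ω => t ^ 2 * S ω ^ 2) μ := hS.integrable_sq.const_mul _
    have i5 : Integrable (fun ω => (F ω - a) ^ 2 - 2 * t * (F ω * S ω)) μ := i1.sub i2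
    have i6 : Integrable (fun ω => (F ω - a) ^ 2 - 2 * t * (F ω * S ω) + 2 * t * a * S ω) μ :=
      i5.add i3
    simp_rw [h3]
    rw [integral_add i6 i4, integral_add i5 i3, integral_sub i1 i2,
      integral_const_mul, integral_const_mul, integral_const_mul, hS0]
    ring
  rw [variance_eq_integral hF.aestronglyMeasurable.aemeasurable, ← ha]
  linarith

lemma memLp_two_of_bounded {Ω : Type*} [MeasurableSpace Ω] {μ : Measure Ω}
    [IsProbabilityMeasure μ] {f : Ω → ℝ} (hf : Measurable f) {M : ℝ} (hM : ∀ ω, |f ω| ≤ M) :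
    MemLp f 2 μ :=
  MemLp.of_bound hf.aestronglyMeasurable M (Eventually.of_forall hM)

lemma integral_sum_eval_eq_zero {n d : ℕ} {φ : Euc d → ℝ} (hφ : Measurable φ)
    (hint : Integrable φ (stdGaussian (Euc d))) (h0 : ∫ x, φ x ∂(stdGaussian (Euc d)) = 0) :
    ∫ X, ∑ i, φ (X i) ∂(gaussPi n d) = 0 := by
  have hmp := fun i => measurePreserving_eval (fun _ : Fin n => stdGaussian (Euc d)) i
  have hi : ∀ i, Integrable (fun X : Fin n → Euc d => φ (X i)) (gaussPi n d) := fun i =>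
    (hmp i).integrable_comp_of_integrable hint
  rw [integral_finsetSum _ fun i _ => hi i]
  refine Finset.sum_eq_zero fun i _ => ?_
  rw [← h0, ← (hmp i).map_eq, integral_map (hmp i).measurable.aemeasurable
    hφ.aestronglyMeasurable]

lemma integral_sq_sum_eval {n d : ℕ} {φ : Euc d → ℝ} (hφ : Measurable φ)
    (hL : MemLp φ 2 (stdGaussian (Euc d))) (h0 : ∫ x, φ x ∂(stdGaussian (Euc d)) = 0) :
    ∫ X, (∑ i, φ (X i)) ^ 2 ∂(gaussPi n d) = n * ∫ x, φ x ^ 2 ∂(stdGaussian (Euc d)) := by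
  have h1 := variance_sum_pi (μ := fun _ : Fin n => stdGaussian (Euc d)) (X := fun _ => φ)
    fun _ => hL
  have h2 : (∑ i : Fin n, fun ω : Fin n → Euc d => φ (ω i)) = fun X => ∑ i, φ (X i) := by
    ext X; simp
  have h3 : Measurable fun X : Fin n → Euc d => ∑ i, φ (X i) :=
    Finset.measurable_fun_sum _ fun i _ => hφ.comp (measurable_pi_apply i)
  rw [h2, variance_of_integral_eq_zero h3.aemeasurable
    (integral_sum_eval_eq_zero hφ (hL.integrable one_le_two) h0)] at h1
  rw [h1, variance_of_integral_eq_zero hφ.aemeasurable h0]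
  simp

/-! ### The averaged hull volume and its covariance with radial statistics -/

lemma hullVol_rotCoord_le {d ℓ n : ℕ} (hℓ : ℓ ≤ d) (g : OrthGroup d) (X : Fin n → Euc d) :
    hullVol (rotCoord hℓ g X) ≤ unitBallVol ℓ * ∑ i, ‖X i‖ ^ ℓ := by
  refine (hullVol_le _).trans ?_
  unfold unitBallVol
  gcongr with i
  exact norm_rotCoord_le hℓ g X i

/-- The mean volume, over a Haar distributed rotation, of the projected hull. -/
noncomputable def meanHullVol {d ℓ n : ℕ} (hℓ : ℓ ≤ d) (X : Fin n → Euc d) : ℝ :=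
  ∫ g, hullVol (rotCoord hℓ g X) ∂(orthHaar d)

lemma meanHullVol_nonneg {d ℓ n : ℕ} (hℓ : ℓ ≤ d) (X : Fin n → Euc d) : 0 ≤ meanHullVol hℓ X :=
  integral_nonneg fun _ => hullVol_nonneg _

lemma measurable_meanHullVol {d ℓ n : ℕ} (hℓ : ℓ ≤ d) :
    Measurable (meanHullVol hℓ : (Fin n → Euc d) → ℝ) :=
  (measurable_hullVol_rotCoord hℓ).stronglyMeasurable.integral_prod_left.measurable

lemma memLp_meanHullVol {d ℓ n : ℕ} (hℓ : ℓ ≤ d) :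
    MemLp (meanHullVol hℓ : (Fin n → Euc d) → ℝ) 2 (gaussPi n d) := by
  refine ((memLp_const_add_sum_norm_pow n d ℓ 0).const_mul (unitBallVol ℓ)).mono'
    (measurable_meanHullVol hℓ).aestronglyMeasurable (Eventually.of_forall fun X => ?_)
  rw [Real.norm_of_nonneg (meanHullVol_nonneg hℓ X), zero_add]
  refine (integral_mono_of_nonneg (Eventually.of_forall fun g => hullVol_nonneg _)
    (integrable_const _) (Eventually.of_forall fun g => hullVol_rotCoord_le hℓ g X)).trans ?_
  simp

lemma memLp_hullVol_coordMap {d ℓ n : ℕ} (hℓ : ℓ ≤ d) :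
    MemLp (fun X : Fin n → Euc d => hullVol fun i => coordMap hℓ (X i)) 2 (gaussPi n d) :=
  (memLp_hullVol n ℓ).comp_measurePreserving
    (measurePreserving_pi (fun _ => stdGaussian (Euc d)) (fun _ => stdGaussian (Euc ℓ))
      fun _ => measurePreserving_coordMap hℓ)

/-- For a rotation invariant statistic `S` the average over rotations can be dropped: the Gaussian
law of the sample is rotation invariant. -/
lemma integral_meanHullVol_mul {d ℓ n : ℕ} (hℓ : ℓ ≤ d) {S : (Fin n → Euc d) → ℝ}
    (hS : Measurable S) {M : ℝ} (hM : ∀ X, |S X| ≤ M)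
    (hinv : ∀ (T : Euc d ≃ₗᵢ[ℝ] Euc d) X, S (fun i => T (X i)) = S X) :
    ∫ X, meanHullVol hℓ X * S X ∂(gaussPi n d) =
      ∫ X, (hullVol fun i => coordMap hℓ (X i)) * S X ∂(gaussPi n d) := by
  set V : (Fin n → Euc d) → ℝ := fun X => hullVol fun i => coordMap hℓ (X i) with hV
  have hVm : Measurable V := measurable_hullVol.comp
    (measurable_pi_lambda _ fun i =>
      (coordMap hℓ).continuous.measurable.comp (measurable_pi_apply i))
  have hint : Integrable (fun q : OrthGroup d × (Fin n → Euc d) =>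
      hullVol (rotCoord hℓ q.1 q.2) * S q.2) ((orthHaar d).prod (gaussPi n d)) := by
    have hb : Integrable (fun q : OrthGroup d × (Fin n → Euc d) =>
        unitBallVol ℓ * (0 + ∑ i, ‖q.2 i‖ ^ ℓ) * M) ((orthHaar d).prod (gaussPi n d)) :=
      (((((memLp_const_add_sum_norm_pow n d ℓ 0).integrable one_le_two).const_mul _).mul_const
        M).comp_snd (orthHaar d))
    refine hb.mono' ((measurable_hullVol_rotCoord hℓ).mul
      (hS.comp measurable_snd)).aestronglyMeasurable (Eventually.of_forall fun q => ?_)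
    rw [norm_mul, Real.norm_of_nonneg (hullVol_nonneg _), zero_add]
    exact mul_le_mul (hullVol_rotCoord_le hℓ _ _) (hM _) (abs_nonneg _)
      (mul_nonneg measureReal_nonneg (Finset.sum_nonneg fun i _ => by positivity))
  have hin : ∀ g : OrthGroup d, ∫ X, hullVol (rotCoord hℓ g X) * S X ∂(gaussPi n d) =
      ∫ X, V X * S X ∂(gaussPi n d) := fun g => by
    set T := (Unitary.linearIsometryEquiv g).symm with hT
    have h1 : MeasurePreserving T (stdGaussian (Euc d)) (stdGaussian (Euc d)) :=
      ⟨T.continuous.measurable, stdGaussian_map T⟩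
    have h2 : MeasurePreserving (fun (X : Fin n → Euc d) i => T (X i)) (gaussPi n d)
        (gaussPi n d) := measurePreserving_pi _ _ fun _ => h1
    have hVS : Measurable fun X => V X * S X := hVm.mul hS
    conv_rhs => rw [← h2.map_eq]
    rw [integral_map h2.measurable.aemeasurable hVS.aestronglyMeasurable]
    refine integral_congr_ae (Eventually.of_forall fun X => ?_)
    change _ = V _ * S _
    rw [hinv T X]
    rfl
  calc ∫ X, meanHullVol hℓ X * S X ∂(gaussPi n d)
      = ∫ X, ∫ g, hullVol (rotCoord hℓ g X) * S X ∂(orthHaar d) ∂(gaussPi n d) := by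
        refine integral_congr_ae (Eventually.of_forall fun X => ?_)
        exact (integral_mul_const _ _).symm
    _ = ∫ g, ∫ X, hullVol (rotCoord hℓ g X) * S X ∂(gaussPi n d) ∂(orthHaar d) :=
        (integral_integral_swap (f := fun g X => hullVol (rotCoord hℓ g X) * S X) hint).symm
    _ = _ := by simp [hin, hV]

lemma integral_hullVol_cons {m ℓ : ℕ} (z : Euc ℓ) :
    ∫ Z, hullVol (Fin.cons z Z : Fin (m + 1) → Euc ℓ) ∂(gaussPi m ℓ) =
      expGain m ℓ z + ∫ Z, hullVol Z ∂(gaussPi m ℓ) := by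
  rw [expGain, integral_sub ((memLp_hullVol_cons z).integrable one_le_two)
    ((memLp_hullVol m ℓ).integrable one_le_two)]
  ring

/-- Conditioning on the `i`-th point, the covariance of the hull volume with `φ (X_i)` only sees
the expected gain. -/
lemma integral_hullVol_mul_eval {d ℓ m : ℕ} (hℓ : ℓ ≤ d) {φ : Euc d → ℝ} (hφ : Measurable φ)
    {M : ℝ} (hM : ∀ x, |φ x| ≤ M) (h0 : ∫ x, φ x ∂(stdGaussian (Euc d)) = 0) (i : Fin (m + 1)) :
    Integrable (fun x => φ x * expGain m ℓ (coordMap hℓ x)) (stdGaussian (Euc d)) ∧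
    ∫ X, (hullVol fun j => coordMap hℓ (X j)) * φ (X i) ∂(gaussPi (m + 1) d) =
      ∫ x, φ x * expGain m ℓ (coordMap hℓ x) ∂(stdGaussian (Euc d)) := by
  have hφL : MemLp φ 2 (stdGaussian (Euc d)) := memLp_two_of_bounded hφ hM
  have hφi := hφL.integrable one_le_two
  set f : (Fin (m + 1) → Euc d) → ℝ := fun X => (hullVol fun j => coordMap hℓ (X j)) * φ (X i)
    with hf
  have hfi : Integrable f (gaussPi (m + 1) d) :=
    (memLp_hullVol_coordMap hℓ).integrable_mul
      (memLp_two_of_bounded (hφ.comp (measurable_pi_apply i)) fun X => hM (X i))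
  have hmp := (measurePreserving_piFinSuccAbove
    (fun _ : Fin (m + 1) => stdGaussian (Euc d)) i).symm
  set W₀ := ∫ Z, hullVol Z ∂(gaussPi m ℓ) with hW₀
  set h : Euc d × (Fin m → Euc d) → ℝ := fun q =>
    hullVol (Fin.cons (coordMap hℓ q.1) fun j => coordMap hℓ (q.2 j) : Fin (m + 1) → Euc ℓ) *
      φ q.1 with hh
  have hfh : ∀ q, f ((MeasurableEquiv.piFinSuccAbove (fun _ : Fin (m + 1) => Euc d) i).symm q) =
      h q := fun q => by
    have h1 : (MeasurableEquiv.piFinSuccAbove (fun _ : Fin (m + 1) => Euc d) i).symm q =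
        i.insertNth q.1 q.2 := rfl
    have h2 : (Set.range fun j => coordMap hℓ ((i.insertNth q.1 q.2 : Fin (m + 1) → Euc d) j)) =
        Set.range (Fin.cons (coordMap hℓ q.1) fun j => coordMap hℓ (q.2 j) :
          Fin (m + 1) → Euc ℓ) := by
      rw [Fin.range_cons, show (fun j => coordMap hℓ
        ((i.insertNth q.1 q.2 : Fin (m + 1) → Euc d) j)) = coordMap hℓ ∘
          (i.insertNth q.1 q.2 : Fin (m + 1) → Euc d) from rfl, Set.range_comp,
        Fin.range_insertNth]
      change coordMap hℓ '' insert _ _ = _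
      rw [Set.image_insert_eq, ← Set.range_comp]
      rfl
    simp only [hf, hh, h1, hullVol, h2, Fin.insertNth_apply_same]
  have hhi : Integrable h ((stdGaussian (Euc d)).prod (gaussPi m d)) := by
    have := (hmp.integrable_comp_emb (MeasurableEquiv.measurableEmbedding _)).2 hfi
    exact this.congr (Eventually.of_forall hfh)
  have hinner : ∀ x, ∫ Y, h (x, Y) ∂(gaussPi m d) =
      φ x * expGain m ℓ (coordMap hℓ x) + φ x * W₀ := fun x => by
    have h2 : MeasurePreserving (fun (Y : Fin m → Euc d) j => coordMap hℓ (Y j)) (gaussPi m d)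
        (gaussPi m ℓ) := measurePreserving_pi _ _ fun _ => measurePreserving_coordMap hℓ
    simp only [hh]
    rw [integral_mul_const, ← mul_add, ← integral_hullVol_cons, ← h2.map_eq,
      integral_map h2.measurable.aemeasurable
        (measurable_hullVol_cons_right _).aestronglyMeasurable, mul_comm]
  have hii := hhi.integral_prod_left
  simp_rw [hinner] at hii
  have hG : Integrable (fun x => φ x * expGain m ℓ (coordMap hℓ x)) (stdGaussian (Euc d)) := by
    refine (hii.sub (hφi.mul_const W₀)).congr (Eventually.of_forall fun x => ?_)
    simp
  refine ⟨hG, ?_⟩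
  calc ∫ X, f X ∂(gaussPi (m + 1) d) = ∫ q, h q ∂((stdGaussian (Euc d)).prod (gaussPi m d)) := by
        rw [← hmp.integral_comp (MeasurableEquiv.measurableEmbedding _)]
        exact integral_congr_ae (Eventually.of_forall hfh)
    _ = ∫ x, (φ x * expGain m ℓ (coordMap hℓ x) + φ x * W₀) ∂(stdGaussian (Euc d)) := by
        rw [integral_prod _ hhi]
        simp_rw [hinner]
    _ = _ := by
        rw [integral_add hG (hφi.mul_const W₀), integral_mul_const, h0, zero_mul, add_zero]

/-- The centred radial test function `1_A - (γ(A) / γ(B)) 1_B`, with `A` a thin shell of radius `R`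
and `B` the unit ball. -/
noncomputable def shellTest (d : ℕ) (R : ℝ) : Euc d → ℝ := fun x =>
  (shell d R (R + 1 / R)).indicator 1 x -
    (stdGaussian (Euc d)).real (shell d R (R + 1 / R)) /
      (stdGaussian (Euc d)).real (Metric.closedBall 0 1) *
        (Metric.closedBall (0 : Euc d) 1).indicator 1 x

lemma measurable_shellTest (d : ℕ) (R : ℝ) : Measurable (shellTest d R) :=
  (measurable_one.indicator (measurableSet_shell _ _ _)).sub
    ((measurable_one.indicator Metric.isClosed_closedBall.measurableSet).const_mul _)

lemma indicator_one_mem_Icc {α : Type*} (s : Set α) (x : α) :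
    s.indicator (1 : α → ℝ) x ∈ Set.Icc 0 1 := by
  by_cases h : x ∈ s <;> simp [h]

lemma abs_shellTest_le (d : ℕ) (R : ℝ) (x : Euc d) :
    |shellTest d R x| ≤ 1 + (stdGaussian (Euc d)).real (shell d R (R + 1 / R)) /
      (stdGaussian (Euc d)).real (Metric.closedBall 0 1) := by
  have h1 := indicator_one_mem_Icc (shell d R (R + 1 / R)) x
  have h2 := indicator_one_mem_Icc (Metric.closedBall (0 : Euc d) 1) x
  have h3 : 0 ≤ (stdGaussian (Euc d)).real (shell d R (R + 1 / R)) /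
      (stdGaussian (Euc d)).real (Metric.closedBall 0 1) := by positivity
  rw [abs_le, shellTest]
  constructor <;> nlinarith [h1.1, h1.2, mul_nonneg h3 h2.1, mul_le_mul_of_nonneg_left h2.2 h3]

lemma shellTest_linearIsometryEquiv {d : ℕ} (R : ℝ) (T : Euc d ≃ₗᵢ[ℝ] Euc d) (x : Euc d) :
    shellTest d R (T x) = shellTest d R x := by
  have h1 : (shell d R (R + 1 / R)).indicator (1 : Euc d → ℝ) (T x) =
      (shell d R (R + 1 / R)).indicator 1 x := by
    have h : T x ∈ shell d R (R + 1 / R) ↔ x ∈ shell d R (R + 1 / R) := by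
      change (_ ≤ ‖T x‖ ∧ ‖T x‖ ≤ _) ↔ (_ ≤ ‖x‖ ∧ ‖x‖ ≤ _)
      rw [T.norm_map]
    by_cases hx : x ∈ shell d R (R + 1 / R)
    · rw [Set.indicator_of_mem hx, Set.indicator_of_mem (h.2 hx)]
      rfl
    · rw [Set.indicator_of_notMem hx, Set.indicator_of_notMem (h.not.2 hx)]
  have h2 : (Metric.closedBall (0 : Euc d) 1).indicator (1 : Euc d → ℝ) (T x) =
      (Metric.closedBall 0 1).indicator 1 x := by
    simp [Set.indicator]
  rw [shellTest, shellTest, h1, h2]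

lemma integral_shellTest (d : ℕ) (R : ℝ) : ∫ x, shellTest d R x ∂(stdGaussian (Euc d)) = 0 := by
  have hA := measurableSet_shell d R (R + 1 / R)
  have hB : MeasurableSet (Metric.closedBall (0 : Euc d) 1) :=
    Metric.isClosed_closedBall.measurableSet
  have hq := (stdGaussian_closedBall_pos d).ne'
  have hiA : Integrable ((shell d R (R + 1 / R)).indicator (1 : Euc d → ℝ)) (stdGaussian (Euc d)) :=
    (integrable_const (1 : ℝ)).indicator hA
  have hiB : Integrable ((Metric.closedBall (0 : Euc d) 1).indicator (1 : Euc d → ℝ))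
      (stdGaussian (Euc d)) := (integrable_const (1 : ℝ)).indicator hB
  unfold shellTest
  rw [integral_sub hiA (hiB.const_mul _), integral_const_mul,
    integral_indicator_one hA, integral_indicator_one hB, div_mul_cancel₀ _ hq, sub_self]

lemma integral_sq_shellTest_le (d : ℕ) (R : ℝ) :
    ∫ x, shellTest d R x ^ 2 ∂(stdGaussian (Euc d)) ≤
      2 * (1 + 1 / (stdGaussian (Euc d)).real (Metric.closedBall 0 1)) *
        (stdGaussian (Euc d)).real (shell d R (R + 1 / R)) := by
  have hA := measurableSet_shell d R (R + 1 / R)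
  have hB : MeasurableSet (Metric.closedBall (0 : Euc d) 1) :=
    Metric.isClosed_closedBall.measurableSet
  have hq := stdGaussian_closedBall_pos d
  set p := (stdGaussian (Euc d)).real (shell d R (R + 1 / R)) with hp
  set q := (stdGaussian (Euc d)).real (Metric.closedBall (0 : Euc d) 1) with hqd
  have hp0 : 0 ≤ p := measureReal_nonneg
  have hp1 : p ≤ 1 := measureReal_le_one
  have hiA : Integrable ((shell d R (R + 1 / R)).indicator (1 : Euc d → ℝ)) (stdGaussian (Euc d)) :=
    (integrable_const (1 : ℝ)).indicator hA
  have hiB : Integrable ((Metric.closedBall (0 : Euc d) 1).indicator (1 : Euc d → ℝ))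
      (stdGaussian (Euc d)) := (integrable_const (1 : ℝ)).indicator hB
  have hpt : ∀ x, shellTest d R x ^ 2 ≤ 2 * (shell d R (R + 1 / R)).indicator 1 x +
      2 * (p / q) ^ 2 * (Metric.closedBall (0 : Euc d) 1).indicator 1 x := fun x => by
    have h1 := indicator_one_mem_Icc (shell d R (R + 1 / R)) x
    have h2 := indicator_one_mem_Icc (Metric.closedBall (0 : Euc d) 1) x
    rw [shellTest, ← hp, ← hqd]
    set s := (shell d R (R + 1 / R)).indicator (1 : Euc d → ℝ) x
    set t := (Metric.closedBall (0 : Euc d) 1).indicator (1 : Euc d → ℝ) x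
    have h3 : s ^ 2 ≤ s := by nlinarith [h1.1, h1.2]
    have h4 : t ^ 2 ≤ t := by nlinarith [h2.1, h2.2]
    have h5 := mul_le_mul_of_nonneg_left h4 (sq_nonneg (p / q))
    nlinarith [sq_nonneg (s + p / q * t)]
  have hi2 := (hiA.const_mul 2).add (hiB.const_mul (2 * (p / q) ^ 2))
  refine (integral_mono (memLp_two_of_bounded (measurable_shellTest d R)
    (abs_shellTest_le d R)).integrable_sq hi2 hpt).trans ?_
  simp only [Pi.add_apply]
  rw [integral_add (hiA.const_mul 2) (hiB.const_mul _), integral_const_mul, integral_const_mul,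
    integral_indicator_one hA, integral_indicator_one hB, ← hp, ← hqd]
  have h6 : (p / q) ^ 2 * q = p ^ 2 / q := by field_simp
  have h7 : p ^ 2 / q ≤ p / q := by
    gcongr
    nlinarith
  have h8 : 2 * (1 + 1 / q) * p = 2 * p + 2 * (p / q) := by ring
  rw [h8, mul_assoc, h6]
  linarith

/-! ### The lower bound on the variance -/

lemma le_integral_shellTest_mul {d ℓ m : ℕ} (hℓ : ℓ ≤ d) {R a η : ℝ}
    (hη : 0 ≤ η) (hlow : ∀ z : Euc ℓ, R ≤ ‖z‖ → a ≤ expGain m ℓ z)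
    (hup : ∀ z : Euc ℓ, ‖z‖ ≤ 1 → expGain m ℓ z ≤ η)
    (hint : Integrable (fun x => shellTest d R x * expGain m ℓ (coordMap hℓ x))
      (stdGaussian (Euc d))) :
    a * (stdGaussian (Euc d)).real {x | R ≤ ‖coordMap hℓ x‖ ∧ ‖x‖ ≤ R + 1 / R} - η ≤
      ∫ x, shellTest d R x * expGain m ℓ (coordMap hℓ x) ∂(stdGaussian (Euc d)) := by
  set A' : Set (Euc d) := {x | R ≤ ‖coordMap hℓ x‖ ∧ ‖x‖ ≤ R + 1 / R} with hA'
  have hA'm : MeasurableSet A' :=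
    (measurableSet_le measurable_const (coordMap hℓ).continuous.norm.measurable).inter
      (measurableSet_le measurable_norm measurable_const)
  have hB : MeasurableSet (Metric.closedBall (0 : Euc d) 1) :=
    Metric.isClosed_closedBall.measurableSet
  have hq := stdGaussian_closedBall_pos d
  set p := (stdGaussian (Euc d)).real (shell d R (R + 1 / R)) with hp
  set q := (stdGaussian (Euc d)).real (Metric.closedBall (0 : Euc d) 1) with hqd
  have hp1 : p ≤ 1 := measureReal_le_one
  have hpq : 0 ≤ p / q := div_nonneg measureReal_nonneg hq.le
  have hiA : Integrable (A'.indicator (1 : Euc d → ℝ)) (stdGaussian (Euc d)) :=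
    (integrable_const (1 : ℝ)).indicator hA'm
  have hiB : Integrable ((Metric.closedBall (0 : Euc d) 1).indicator (1 : Euc d → ℝ))
      (stdGaussian (Euc d)) := (integrable_const (1 : ℝ)).indicator hB
  have hpt : ∀ x, a * A'.indicator 1 x -
      p / q * η * (Metric.closedBall (0 : Euc d) 1).indicator 1 x ≤
        shellTest d R x * expGain m ℓ (coordMap hℓ x) := fun x => by
    have hG := expGain_nonneg m ℓ (coordMap hℓ x)
    rw [shellTest, ← hp, ← hqd, sub_mul]
    refine sub_le_sub ?_ ?_
    · by_cases hx : x ∈ A'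
      · have hx' : x ∈ shell d R (R + 1 / R) := ⟨hx.1.trans (norm_coordMap_le hℓ x), hx.2⟩
        rw [Set.indicator_of_mem hx, Set.indicator_of_mem hx']
        simpa using hlow _ hx.1
      · rw [Set.indicator_of_notMem hx, mul_zero]
        exact mul_nonneg (indicator_one_mem_Icc _ _).1 hG
    · rw [mul_assoc, mul_assoc]
      refine mul_le_mul_of_nonneg_left ?_ hpq
      by_cases hx : x ∈ Metric.closedBall (0 : Euc d) 1
      · rw [Set.indicator_of_mem hx]
        simpa using hup _ ((norm_coordMap_le hℓ x).trans (by simpa using hx))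
      · rw [Set.indicator_of_notMem hx]
        simp
  refine le_trans ?_ (integral_mono ((hiA.const_mul a).sub (hiB.const_mul (p / q * η))) hint hpt)
  simp only [Pi.sub_apply]
  rw [integral_sub (hiA.const_mul _) (hiB.const_mul _), integral_const_mul, integral_const_mul,
    integral_indicator_one hA'm, integral_indicator_one hB, ← hqd]
  have h1 : p / q * η * q = p * η := by field_simp
  rw [h1]
  nlinarith

/-- The test statistic is `S = ∑ φ (X_i)` with `φ` the shell test function: its second moment is at
most of order `R^(d-1)`, its covariance with the mean hull volume at least of order `R^(ℓ-2)`;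
here `ℓ = k + 1` and `d = k + 1 + e`. -/
lemma exists_le_variance_meanHullVol (k e : ℕ) : ∃ c R₀ : ℝ, 0 < c ∧ ∀ R, R₀ ≤ R → ∀ m : ℕ,
    (m + 1 : ℝ) = R * Real.exp (R ^ 2 / 2) →
      c * ((R ^ k / R) ^ 2 / R ^ (k + e)) ≤
        Var[meanHullVol (Nat.le_add_right (k + 1) e); gaussPi (m + 1) (k + 1 + e)] := by
  set d := k + 1 + e with hd
  have hℓ : k + 1 ≤ d := Nat.le_add_right (k + 1) e
  obtain ⟨c₁, R₁, hc₁, hlow⟩ := exists_le_expGain k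
  obtain ⟨c₂, hc₂, hmass⟩ := exists_le_stdGaussian_shell k e
  obtain ⟨C₁, ρ, hC₁, hρ0, hρ1, hup⟩ := exists_expGain_le (k + 1)
  obtain ⟨C₂, hC₂, hshell⟩ := exists_stdGaussian_shell_le (k + e)
  have hq := stdGaussian_closedBall_pos d
  set q := (stdGaussian (Euc d)).real (Metric.closedBall (0 : Euc d) 1) with hqd
  have htend := (tendsto_pow_const_mul_const_pow_of_lt_one 4 hρ0.le hρ1).eventually_lt_const
    (by positivity : 0 < c₁ * c₂ * ρ / (2 * C₁))
  obtain ⟨N, hN⟩ := eventually_atTop.1 htend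
  set C₃ : ℝ := 2 * (1 + 1 / q) * C₂ with hC₃
  have hC₃0 : 0 < C₃ := by positivity
  refine ⟨(c₁ * c₂ / 2) ^ 2 / C₃, max (max R₁ N) 1, by positivity, fun R hR m hm => ?_⟩
  have hRR₁ : R₁ ≤ R := ((le_max_left _ _).trans (le_max_left _ _)).trans hR
  have hRN : (N : ℝ) ≤ R := ((le_max_right _ _).trans (le_max_left _ _)).trans hR
  have hR1 : 1 ≤ R := (le_max_right _ _).trans hR
  have hR0 : 0 < R := by linarith
  set n : ℝ := m + 1 with hn
  have hn0 : 0 < n := by positivity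
  have hnR : R ≤ n := by
    rw [hm]
    exact le_mul_of_one_le_right hR0.le (Real.one_le_exp (by positivity))
  set η : ℝ := C₁ * n ^ 2 * ρ ^ m with hη
  have hη0 : 0 ≤ η := by positivity
  -- The contribution of the unit ball is negligible.
  have hnη : n * η ≤ c₁ * c₂ / 2 * (R ^ k / R) := by
    have h1 : n ^ 4 * ρ ^ (m + 1) < c₁ * c₂ * ρ / (2 * C₁) := by
      have := hN (m + 1) (by
        have : (N : ℝ) ≤ ((m + 1 : ℕ) : ℝ) := by push_cast; linarith
        exact_mod_cast this)
      push_cast at this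
      exact this
    have h2 : n ^ 4 * ρ ^ m * C₁ ≤ c₁ * c₂ / 2 := by
      rw [lt_div_iff₀ (by positivity), pow_succ ρ m] at h1
      have h3 : (n ^ 4 * ρ ^ m * C₁) * ρ ≤ (c₁ * c₂ / 2) * ρ := by linarith
      exact le_of_mul_le_mul_right h3 hρ0
    have h4 : 1 / n ≤ R ^ k / R := by
      gcongr
      exact one_le_pow₀ hR1
    calc n * η = (n ^ 4 * ρ ^ m * C₁) * (1 / n) := by rw [hη]; field_simp
      _ ≤ c₁ * c₂ / 2 * (R ^ k / R) := by gcongr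
  set φ := shellTest d R with hφ
  have hφm : Measurable φ := measurable_shellTest d R
  have hφb := abs_shellTest_le d R
  have hφ0 : ∫ x, φ x ∂(stdGaussian (Euc d)) = 0 := integral_shellTest d R
  have hφL : MemLp φ 2 (stdGaussian (Euc d)) := memLp_two_of_bounded hφm hφb
  set S : (Fin (m + 1) → Euc d) → ℝ := fun X => ∑ i, φ (X i) with hS
  have hSm : Measurable S := Finset.measurable_fun_sum _ fun i _ =>
    hφm.comp (measurable_pi_apply i)
  set M := 1 + (stdGaussian (Euc d)).real (shell d R (R + 1 / R)) / q with hM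
  have hSb : ∀ X, |S X| ≤ ∑ _i : Fin (m + 1), M := fun X =>
    (Finset.abs_sum_le_sum_abs _ _).trans (Finset.sum_le_sum fun i _ => hφb (X i))
  have hSL : MemLp S 2 (gaussPi (m + 1) d) := memLp_two_of_bounded hSm hSb
  have hcov : c₁ * c₂ / 2 * (R ^ k / R) ≤
      ∫ X, meanHullVol hℓ X * S X ∂(gaussPi (m + 1) d) := by
    have hi := fun i => integral_hullVol_mul_eval hℓ hφm hφb hφ0 (m := m) i
    have hint : ∀ i ∈ Finset.univ, Integrable (fun X : Fin (m + 1) → Euc d =>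
        (hullVol fun j => coordMap hℓ (X j)) * φ (X i)) (gaussPi (m + 1) d) := fun i _ =>
      (memLp_hullVol_coordMap hℓ).integrable_mul
        (memLp_two_of_bounded (hφm.comp (measurable_pi_apply i)) fun X => hφb (X i))
    rw [integral_meanHullVol_mul hℓ hSm hSb fun T X => by
      simp only [hS, hφ, shellTest_linearIsometryEquiv]]
    simp only [hS, Finset.mul_sum]
    rw [integral_finsetSum _ hint, Finset.sum_congr rfl fun i _ => (hi i).2, Finset.sum_const,
      Finset.card_univ, Fintype.card_fin, nsmul_eq_mul, Nat.cast_succ, ← hn]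
    have h1 := le_integral_shellTest_mul hℓ hη0
      (fun z hz => hlow R hRR₁ m hm z hz) (fun z hz => hup m z hz) (hi 0).1
    have h2 := hmass R hR1
    rw [← hm] at h2
    calc c₁ * c₂ / 2 * (R ^ k / R) ≤ c₁ * c₂ * (R ^ k / R) - n * η := by linarith
      _ = n * (c₁ / R * (c₂ * R ^ k / n) - η) := by field_simp
      _ ≤ n * (c₁ / R * (stdGaussian (Euc d)).real
            {x | R ≤ ‖coordMap hℓ x‖ ∧ ‖x‖ ≤ R + 1 / R} - η) := by gcongr
      _ ≤ _ := by gcongr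
  have hsq : ∫ X, S X ^ 2 ∂(gaussPi (m + 1) d) ≤ C₃ * R ^ (k + e) := by
    rw [integral_sq_sum_eval hφm hφL hφ0]
    have hde : d = k + e + 1 := by omega
    have h1 : (stdGaussian (Euc d)).real (shell d R (R + 1 / R)) ≤ C₂ * R ^ (k + e) / n := by
      have := hshell R hR1
      rw [← hm] at this
      rw [hde]
      exact this
    calc ((m + 1 : ℕ) : ℝ) * ∫ x, φ x ^ 2 ∂(stdGaussian (Euc d))
        ≤ n * (2 * (1 + 1 / q) * (C₂ * R ^ (k + e) / n)) := by
          rw [Nat.cast_succ, ← hn]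
          gcongr
          refine (integral_sq_shellTest_le d R).trans ?_
          rw [← hqd]
          gcongr
      _ = C₃ * R ^ (k + e) := by rw [hC₃]; field_simp
  set b := c₁ * c₂ / 2 * (R ^ k / R) with hb
  have hb0 : 0 ≤ b := by positivity
  set s := C₃ * R ^ (k + e) with hs
  have hs0 : 0 < s := by positivity
  -- `t = b / s` maximizes the lower bound `2 t b - t² s`.
  have hvar := two_mul_sub_le_variance (memLp_meanHullVol hℓ) hSL
    (integral_sum_eval_eq_zero hφm (hφL.integrable one_le_two) hφ0) (b / s)
  refine le_trans ?_ hvar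
  calc (c₁ * c₂ / 2) ^ 2 / C₃ * ((R ^ k / R) ^ 2 / R ^ (k + e))
      = 2 * (b / s) * b - (b / s) ^ 2 * s := by
        have : 2 * (b / s) * b - (b / s) ^ 2 * s = b ^ 2 / s := by field_simp; ring
        rw [this, hb, hs]
        field_simp
    _ ≤ _ := by gcongr

/-- The radius `R` attached to `n`; it is as large as desired once `n` is large. -/
lemma exists_mul_exp_sq_eq {R₀ : ℝ} (hR₀ : 1 ≤ R₀) {n : ℕ}
    (hn : R₀ * Real.exp (R₀ ^ 2 / 2) ≤ n) :
    ∃ R, R₀ ≤ R ∧ (n : ℝ) = R * Real.exp (R ^ 2 / 2) := by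
  have h1 : R₀ ≤ n := (le_mul_of_one_le_right (by linarith) (Real.one_le_exp (by positivity))).trans
    hn
  have h2 : (n : ℝ) ≤ n * Real.exp ((n : ℝ) ^ 2 / 2) :=
    le_mul_of_one_le_right n.cast_nonneg (Real.one_le_exp (by positivity))
  obtain ⟨R, hR, hRn⟩ := intermediate_value_Icc h1
    (f := fun x : ℝ => x * Real.exp (x ^ 2 / 2)) (by fun_prop) ⟨hn, h2⟩
  exact ⟨R, hR.1, hRn.symm⟩

/-- With `n = R exp (R²/2)` the quantities `log n` and `R²` agree up to a factor `2`. -/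
lemma two_rpow_mul_log_rpow_le {R n : ℝ} (hR : 1 ≤ R) (hn : n = R * Real.exp (R ^ 2 / 2)) (s : ℝ) :
    2 ^ (-|s|) * Real.log n ^ s ≤ (R ^ 2) ^ s := by
  have hR0 : 0 < R := by linarith
  have hlog : Real.log n = Real.log R + R ^ 2 / 2 := by
    rw [hn, Real.log_mul hR0.ne' (Real.exp_pos _).ne', Real.log_exp]
  have h0 := Real.log_nonneg hR
  have hl : R ^ 2 / 2 ≤ Real.log n := by linarith
  have hu : Real.log n ≤ R ^ 2 := by
    have := Real.log_le_sub_one_of_pos hR0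
    nlinarith [sq_nonneg (R - 1)]
  have hpos : 0 < R ^ 2 / 2 := by positivity
  rcases le_total 0 s with hs | hs
  · rw [abs_of_nonneg hs]
    have h1 : (2 : ℝ) ^ (-s) ≤ 1 := Real.rpow_le_one_of_one_le_of_nonpos one_le_two (by linarith)
    have h2 : Real.log n ^ s ≤ (R ^ 2) ^ s := Real.rpow_le_rpow (hpos.le.trans hl) hu hs
    calc (2 : ℝ) ^ (-s) * Real.log n ^ s ≤ 1 * (R ^ 2) ^ s := by
          gcongr
          exact Real.rpow_nonneg (hpos.le.trans hl) _
      _ = _ := one_mul _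
  · rw [abs_of_nonpos hs, neg_neg]
    have h2 : Real.log n ^ s ≤ (R ^ 2 / 2) ^ s := Real.rpow_le_rpow_of_nonpos hpos hl hs
    calc (2 : ℝ) ^ s * Real.log n ^ s ≤ 2 ^ s * (R ^ 2 / 2) ^ s := by gcongr
      _ = (R ^ 2) ^ s := by
        rw [← Real.mul_rpow two_pos.le hpos.le]
        congr 1
        ring

lemma rpow_exponent_eq {R : ℝ} (hR : 0 < R) (k e : ℕ) :
    (R ^ 2) ^ (((k + 1 : ℕ) : ℝ) - (((k + 1 + e : ℕ) : ℝ) + 3) / 2) =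
      (R ^ k / R) ^ 2 / R ^ (k + e) := by
  have h : (R ^ k / R) ^ 2 / R ^ (k + e) = R ^ ((2 * k : ℝ) - 2 - (k + e)) := by
    rw [Real.rpow_sub hR, Real.rpow_sub hR, div_pow, ← pow_mul, ← Real.rpow_natCast R (k * 2),
      ← Real.rpow_natCast R (k + e), ← Real.rpow_natCast R 2]
    push_cast
    ring_nf
  rw [h, ← Real.rpow_natCast R 2, ← Real.rpow_mul hR.le]
  congr 1
  push_cast
  ring

lemma exists_le_variance_intrinsicVol {d ℓ : ℕ} (hℓ₁ : 1 ≤ ℓ) (hℓ : ℓ ≤ d) :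
    ∃ v : ℝ, 0 < v ∧ ∃ N : ℕ, 2 ≤ N ∧ ∀ n : ℕ, N ≤ n →
      MemLp (fun X => intrinsicVol hℓ (convexHull ℝ (Set.range X))) 2 (gaussPi n d) ∧
      v * Real.log n ^ ((ℓ : ℝ) - ((d : ℝ) + 3) / 2) ≤
        Var[fun X => intrinsicVol hℓ (convexHull ℝ (Set.range X)); gaussPi n d] := by
  obtain ⟨k, rfl⟩ : ∃ k, ℓ = k + 1 := ⟨ℓ - 1, by omega⟩
  obtain ⟨e, rfl⟩ := Nat.exists_eq_add_of_le hℓ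
  obtain ⟨c, R₀, hc, hvar⟩ := exists_le_variance_meanHullVol k e
  set s : ℝ := ((k + 1 : ℕ) : ℝ) - (((k + 1 + e : ℕ) : ℝ) + 3) / 2 with hs
  set κ := kubotaConst (k + 1 + e) (k + 1) with hκ
  have hκ0 : 0 < κ := kubotaConst_pos hℓ
  set R₁ := max R₀ 1 with hR₁
  refine ⟨κ ^ 2 * (c * 2 ^ (-|s|)), by positivity, max 2 ⌈R₁ * Real.exp (R₁ ^ 2 / 2)⌉₊,
    le_max_left _ _, fun n hn => ?_⟩
  have hF : (fun X : Fin n → Euc (k + 1 + e) => intrinsicVol hℓ (convexHull ℝ (Set.range X))) =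
      fun X => κ * meanHullVol hℓ X := funext fun X => intrinsicVol_convexHull_range hℓ X
  rw [hF]
  refine ⟨(memLp_meanHullVol hℓ).const_mul κ, ?_⟩
  obtain ⟨R, hR, hRn⟩ := exists_mul_exp_sq_eq (le_max_right R₀ 1)
    ((Nat.le_ceil _).trans (Nat.cast_le.2 ((le_max_right _ _).trans hn)))
  have hR1 : 1 ≤ R := (le_max_right _ _).trans hR
  obtain ⟨m, rfl⟩ : ∃ m, n = m + 1 := ⟨n - 1, by
    have : 2 ≤ n := (le_max_left _ _).trans hn
    omega⟩
  rw [variance_const_mul]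
  have h1 := hvar R ((le_max_left _ _).trans hR) m (by rw [← hRn]; push_cast; rfl)
  have h2 := two_rpow_mul_log_rpow_le hR1 hRn s
  rw [hs, rpow_exponent_eq (by linarith), ← hs] at h2
  calc κ ^ 2 * (c * 2 ^ (-|s|)) * Real.log ((m + 1 : ℕ) : ℝ) ^ s
      = κ ^ 2 * (c * (2 ^ (-|s|) * Real.log ((m + 1 : ℕ) : ℝ) ^ s)) := by ring
    _ ≤ κ ^ 2 * (c * ((R ^ k / R) ^ 2 / R ^ (k + e))) := by gcongr
    _ ≤ _ := by gcongr

lemma memLp_and_variance_comp_of_hasLaw {Ω : Type*} [MeasurableSpace Ω] {P : Measure Ω}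
    {n d : ℕ} {X : Fin n → Ω → Euc d} (hX : ∀ i, HasLaw (X i) (stdGaussian (Euc d)) P)
    (hind : iIndepFun X P) {F : (Fin n → Euc d) → ℝ} (hF : MemLp F 2 (gaussPi n d)) :
    MemLp (fun ω => F fun i => X i ω) 2 P ∧
      Var[fun ω => F fun i => X i ω; P] = Var[F; gaussPi n d] := by
  have hL := hind.hasLaw_pi hX
  have hmap : P.map (fun ω i => X i ω) = gaussPi n d := hL.map_eq
  constructor
  · rw [← hmap] at hF
    exact (memLp_map_measure_iff hF.aestronglyMeasurable hL.aemeasurable).1 hF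
  · have hFm := hF.aestronglyMeasurable.aemeasurable
    rw [← hmap] at hFm ⊢
    exact (variance_map hFm hL.aemeasurable).symm

theorem theorem1 (d ℓ : ℕ) (hℓ₁ : 1 ≤ ℓ) (hℓ : ℓ ≤ d) :
    ∃ v : ℝ, 0 < v ∧
      (∃ N : ℕ, ∀ n : ℕ, N ≤ n →
        ∀ (Ω : Type*) [MeasurableSpace Ω] (P : Measure Ω) [IsProbabilityMeasure P]
          (X : Fin n → Ω → EuclideanSpace ℝ (Fin d)),
          (∀ i, HasLaw (X i) (stdGaussian (EuclideanSpace ℝ (Fin d))) P) →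
          iIndepFun X P →
          MemLp (fun ω => intrinsicVol hℓ (convexHull ℝ (Set.range fun i => X i ω))) 2 P ∧
          v * Real.log n ^ ((ℓ : ℝ) - ((d : ℝ) + 3) / 2) ≤
            Var[fun ω => intrinsicVol hℓ (convexHull ℝ (Set.range fun i => X i ω)); P]) ∧
      (∀ (Ω : Type*) [MeasurableSpace Ω] (P : Measure Ω) [IsProbabilityMeasure P]
          (X : ℕ → Ω → EuclideanSpace ℝ (Fin d)),
          (∀ i, HasLaw (X i) (stdGaussian (EuclideanSpace ℝ (Fin d))) P) →
          iIndepFun X P →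
          ∀ c : ℝ,
            Tendsto (fun n : ℕ => Real.log n ^ (((d : ℝ) + 3) / 2 - (ℓ : ℝ)) *
              Var[fun ω => intrinsicVol hℓ
                (convexHull ℝ (Set.range fun i : Fin n => X i ω)); P]) atTop (𝓝 c) →
            0 < c) := by
  obtain ⟨v, hv, N, hN2, hN⟩ := exists_le_variance_intrinsicVol hℓ₁ hℓ
  refine ⟨v, hv, ⟨N, fun n hn Ω _ P _ X hX hind => ?_⟩, fun Ω _ P _ X hX hind c hc => ?_⟩
  · obtain ⟨h1, h2⟩ := hN n hn
    obtain ⟨h3, h4⟩ := memLp_and_variance_comp_of_hasLaw hX hind h1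
    exact ⟨h3, h2.trans_eq h4.symm⟩
  · refine hv.trans_le (ge_of_tendsto hc (eventually_atTop.2 ⟨N, fun n hn => ?_⟩))
    obtain ⟨h1, h2⟩ := hN n hn
    obtain ⟨-, h4⟩ := memLp_and_variance_comp_of_hasLaw (fun i : Fin n => hX i)
      (hind.precomp Fin.val_injective) h1
    have hlog : 0 < Real.log n := Real.log_pos (by exact_mod_cast hN2.trans hn)
    rw [← neg_sub, Real.rpow_neg hlog.le, inv_mul_eq_div, le_div_iff₀ (by positivity)]
    exact h2.trans_eq h4.symm
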